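/- Theorem 1.2. Let $F$ be an algebraically closed field and let $D_1, D_2$ be division algebras, finite-dimensional over their centers $F_1, F_2$, with $F \subseteq F_1$ and $F \subseteq F_2$. Let $R$ be a discrete valuation ring with fraction field $F_1$ and residue field $k$. Let $\hat F$ be the completion of $F_1$ with respect to $R$. For a class $\alpha \in \mathrm{Br}(F_1)$ that is split by a finite unramified Galois extension $L/\hat F$, say with group $G$ and normalized valuation $v$, let $\mathrm{ram}_R(\alpha) \in H^1(k, \mathbb{Q}/\mathbb{Z})$ be the image of $\alpha|_{\hat F} \in \mathrm{Br}(L/\hat F) = H^2(G, L^*)$ under $$H^2(G, L^*) \xrightarrow{\,v\,} H^2(G, \mathbb{Z}) \cong H^1(G, \mathbb{Q}/\mathbb{Z}) \xrightarrow{\,\mathrm{inf}\,} H^1(k, \mathbb{Q}/\mathbb{Z}),$$ the group of continuous characters of the absolute Galois group of $k$. (This is independent of $L$, and it is defined on all classes of order prime to the characteristic of $k$.) Say that $D_1$ is ramified at $R$ if $\mathrm{ram}_R([D_1])$ is defined and nonzero, and totally ramified at $R$ if $\mathrm{ram}_R([D_1])$ is defined and its order equals the degree $\sqrt{\dim_{F_1}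 D_1}$ of $D_1$. (a) If $D_1$ is totally ramified at $R$, then $D_1 \otimes_F D_2$ is a domain (it is nonzero and has no zero divisors). (b) If $D_1/F_1$ has prime degree $p \neq \operatorname{char} F$ and $D_1$ is ramified at $R$, then $D_1 \otimes_F D_2$ is a domain. -/

import Mathlib

open scoped TensorProduct

/-! ### Crossed product algebras -/

/-- The `2`-cocycles `f : G × G → Lˣ`, where `G = Gal(L/K)`. -/
abbrev GaloisCocycle (K L : Type*) [Field K] [Field L] [Algebra K L] : Type _ :=
  {f : Gal(L/K) × Gal(L/K) → Lˣ // groupCohomology.IsMulCocycle₂ f}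

/-- For a finite Galois extension `L/K` with group `G` and a `2`-cocycle `f : G × G → Lˣ`, the
crossed product algebra `(L/K, G, f) = ⨁_{σ ∈ G} L u_σ`, with multiplication determined by
`u_σ a = σ(a) u_σ` and `u_σ u_τ = f(σ, τ) u_{στ}`.
The element `∑_σ x_σ u_σ` is represented by the function `σ ↦ x_σ`, with entrywise addition and
scalar multiplication. -/
structure CrossedProduct {K L : Type*} [Field K] [Field L] [Algebra K L]
    (f : GaloisCocycle K L) where
  /-- The coefficients `x_σ` of `∑_σ x_σ u_σ`. -/
  coeff : Gal(L/K) → L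

namespace CrossedProduct

variable {K L : Type*} [Field K] [Field L] [Algebra K L] (f : GaloisCocycle K L)

/-- An element of the crossed product is given by its coefficients. -/
def coeffEquiv : CrossedProduct f ≃ (Gal(L/K) → L) where
  toFun := coeff
  invFun := mk
  left_inv _ := rfl
  right_inv _ := rfl

instance : AddCommGroup (CrossedProduct f) := (coeffEquiv f).addCommGroup

instance : Module K (CrossedProduct f) := (coeffEquiv f).module K

/-- The cocycle identity, written in the field `L`. -/
theorem cocycle_eq (g h j : Gal(L/K)) :
    (f.1 (g * h, j) : L) * (f.1 (g, h) : L) = g (f.1 (h, j) : L) * (f.1 (g, h * j) : L) := by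
  have := congrArg (Units.val) (f.2 g h j)
  simpa [AlgEquiv.smul_units_def] using this

theorem cocycle_one_left (g : Gal(L/K)) : (f.1 (1, g) : L) = f.1 (1, 1) := by
  have := cocycle_eq f 1 1 g
  simp only [one_mul, AlgEquiv.one_apply] at this
  exact (mul_left_cancel₀ (f.1 (1, g)).ne_zero this).symm

theorem cocycle_one_right (g : Gal(L/K)) : (f.1 (g, 1) : L) = g (f.1 (1, 1) : L) := by
  have := cocycle_eq f g 1 1
  simp only [mul_one] at this
  exact mul_right_cancel₀ (f.1 (g, 1)).ne_zero this

open scoped Classical in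
/-- The unit element is `f(1,1)⁻¹ u_1`. -/
noncomputable instance : One (CrossedProduct f) where
  one := ⟨fun ρ => if ρ = 1 then (f.1 (1, 1) : L)⁻¹ else 0⟩

variable {f}

theorem coeff_one_one : (1 : CrossedProduct f).coeff 1 = (f.1 (1, 1) : L)⁻¹ := if_pos rfl

theorem coeff_one_of_ne {ρ : Gal(L/K)} (h : ρ ≠ 1) : (1 : CrossedProduct f).coeff ρ = 0 :=
  if_neg h

theorem coeff_add (x y : CrossedProduct f) (ρ : Gal(L/K)) :
    (x + y).coeff ρ = x.coeff ρ + y.coeff ρ := rfl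

theorem coeff_zero (ρ : Gal(L/K)) : (0 : CrossedProduct f).coeff ρ = 0 := rfl

theorem coeff_smul (c : K) (x : CrossedProduct f) (ρ : Gal(L/K)) :
    (c • x).coeff ρ = c • x.coeff ρ := rfl

theorem ext_coeff {x y : CrossedProduct f} (h : ∀ ρ, x.coeff ρ = y.coeff ρ) : x = y :=
  (coeffEquiv f).injective (funext h)

variable (f) [FiniteDimensional K L]

/-- `(∑_σ x_σ u_σ) (∑_τ y_τ u_τ)` has `u_ρ`-coefficient
`∑_σ x_σ σ(y_{σ⁻¹ρ}) f(σ, σ⁻¹ρ)`. -/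
noncomputable instance : Mul (CrossedProduct f) where
  mul x y := ⟨fun ρ =>
    ∑ σ : Gal(L/K), x.coeff σ * σ (y.coeff (σ⁻¹ * ρ)) * (f.1 (σ, σ⁻¹ * ρ) : L)⟩

variable {f}

theorem coeff_mul (x y : CrossedProduct f) (ρ : Gal(L/K)) :
    (x * y).coeff ρ =
      ∑ σ : Gal(L/K), x.coeff σ * σ (y.coeff (σ⁻¹ * ρ)) * (f.1 (σ, σ⁻¹ * ρ) : L) := rfl

protected theorem mul_assoc (x y z : CrossedProduct f) : x * y * z = x * (y * z) := by
  refine ext_coeff fun ρ => ?_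
  simp only [coeff_mul, Finset.sum_mul, map_sum, Finset.mul_sum, map_mul]
  rw [Finset.sum_comm]
  refine Finset.sum_congr rfl fun σ _ => ?_
  rw [← Equiv.sum_comp (Equiv.mulLeft σ)]
  refine Finset.sum_congr rfl fun κ _ => ?_
  have h := cocycle_eq f σ κ (κ⁻¹ * (σ⁻¹ * ρ))
  simp only [Equiv.coe_mulLeft, mul_inv_rev, inv_mul_cancel_left, mul_inv_cancel_left,
    AlgEquiv.mul_apply, mul_assoc] at h ⊢
  linear_combination (x.coeff σ * σ (y.coeff κ) * σ (κ (z.coeff (κ⁻¹ * (σ⁻¹ * ρ))))) * h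

noncomputable instance : Ring (CrossedProduct f) :=
  { (inferInstance : AddCommGroup (CrossedProduct f)),
    (inferInstance : Mul (CrossedProduct f)),
    (inferInstance : One (CrossedProduct f)) with
    mul_assoc := CrossedProduct.mul_assoc
    one_mul := fun x => by
      refine ext_coeff fun ρ => ?_
      rw [coeff_mul, Finset.sum_eq_single 1]
      · rw [coeff_one_one, inv_one, one_mul, cocycle_one_left f ρ,
          AlgEquiv.one_apply]
        have := (f.1 (1, 1)).ne_zero
        field_simp
      · intro σ _ hσ
        rw [coeff_one_of_ne hσ, zero_mul, zero_mul]
      · simp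
    mul_one := fun x => by
      refine ext_coeff fun ρ => ?_
      rw [coeff_mul, Finset.sum_eq_single ρ]
      · rw [inv_mul_cancel, coeff_one_one, cocycle_one_right f ρ, mul_assoc,
          ← map_mul, inv_mul_cancel₀ (f.1 (1, 1)).ne_zero, map_one, mul_one]
      · intro σ _ hσ
        have : σ⁻¹ * ρ ≠ 1 := fun h => hσ (inv_mul_eq_one.mp h)
        rw [coeff_one_of_ne this, map_zero, mul_zero, zero_mul]
      · simp
    left_distrib := fun x y z => by
      refine ext_coeff fun ρ => ?_
      simp only [coeff_mul, coeff_add, map_add, mul_add, add_mul, Finset.sum_add_distrib]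
    right_distrib := fun x y z => by
      refine ext_coeff fun ρ => ?_
      simp only [coeff_mul, coeff_add, add_mul, Finset.sum_add_distrib]
    zero_mul := fun x => by
      refine ext_coeff fun ρ => ?_
      simp only [coeff_mul, coeff_zero, zero_mul, Finset.sum_const_zero]
    mul_zero := fun x => by
      refine ext_coeff fun ρ => ?_
      simp only [coeff_mul, coeff_zero, map_zero, mul_zero, zero_mul, Finset.sum_const_zero] }

noncomputable instance : Algebra K (CrossedProduct f) :=
  Algebra.ofModule
    (fun c x y => by
      refine ext_coeff fun ρ => ?_
      simp only [coeff_mul, coeff_smul, Finset.smul_sum, smul_mul_assoc])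
    (fun c x y => by
      refine ext_coeff fun ρ => ?_
      simp only [coeff_mul, coeff_smul, Finset.smul_sum, map_smul, mul_smul_comm,
        smul_mul_assoc])

end CrossedProduct

/-- Two algebras over a field `K` are Brauer equivalent if they have isomorphic matrix algebras
(of positive sizes). For finite-dimensional central simple algebras this says that they have the
same class in `Br(K)`. -/
def BrauerEquivalent (K A B : Type*) [Field K] [Ring A] [Ring B] [Algebra K A] [Algebra K B] :
    Prop :=
  ∃ m n : ℕ, m ≠ 0 ∧ n ≠ 0 ∧
    Nonempty (Matrix (Fin m) (Fin m) A ≃ₐ[K] Matrix (Fin n) (Fin n) B)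

/-! ### The ramification map of a discrete valuation ring -/

section Ramification

/-- `ℚ/ℤ`, written multiplicatively. -/
abbrev QModZ : Type := Multiplicative (AddCircle (1 : ℚ))

/-- `H¹(k, ℚ/ℤ)`: the group of continuous homomorphisms from the absolute Galois group of `k` to
the discrete group `ℚ/ℤ`, i.e. the homomorphisms with open kernel. -/
def CharacterGroup (k : Type*) [Field k] : Subgroup (Gal(AlgebraicClosure k/k) →* QModZ) where
  carrier := {χ | IsOpen (χ.ker : Set (Gal(AlgebraicClosure k/k)))}
  one_mem' := by simp
  mul_mem' := by
    intro χ ψ hχ hψ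
    rw [Set.mem_ofPred_eq] at hχ hψ ⊢
    refine Subgroup.isOpen_mono (H₁ := χ.ker ⊓ ψ.ker) ?_ (hχ.inter hψ)
    rintro s ⟨h₁, h₂⟩
    have h₁' : χ s = 1 := h₁
    have h₂' : ψ s = 1 := h₂
    simp [MonoidHom.mem_ker, h₁', h₂']
  inv_mem' := by
    intro χ hχ
    rw [Set.mem_ofPred_eq] at hχ ⊢
    have : (χ⁻¹).ker = χ.ker := by
      ext s
      simp [MonoidHom.mem_ker]
    rw [this]
    exact hχ

variable (R F₁ : Type*) [CommRing R] [IsDomain R] [IsDiscreteValuationRing R]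
  [Field F₁] [Algebra R F₁] [IsFractionRing R F₁]

/-- The completion of `F₁` with respect to the valuation of the discrete valuation ring `R`. -/
abbrev CompletedField : Type _ :=
  (IsDiscreteValuationRing.maximalIdeal R).adicCompletion F₁

/-- The valuation ring of the completion of `F₁`, i.e. the completion of `R`. -/
abbrev CompletedRing : Type _ :=
  (IsDiscreteValuationRing.maximalIdeal R).adicCompletionIntegers F₁

variable {F₁} in
/-- The integral closure in `L` of the completion of `R`. -/
abbrev IntegersOf (L : IntermediateField (CompletedField R F₁)
    (AlgebraicClosure (CompletedField R F₁))) : Type _ :=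
  integralClosure (CompletedRing R F₁) L

variable {F₁} in
/-- `x ∈ L` has valuation `m`, for the normalized valuation of a finite *unramified* extension
`L` of the completion of `F₁`. Since `L` is unramified, a uniformizer `π` of `R` is a uniformizer
of `L`, so this means that `x = w π ^ m` with a unit `w` of the valuation ring of `L`. -/
def HasValuation (L : IntermediateField (CompletedField R F₁)
    (AlgebraicClosure (CompletedField R F₁))) (x : L) (m : ℤ) : Prop :=
  ∃ (π : R) (w : (IntegersOf R L)ˣ), Irreducible π ∧
    x = ((w : IntegersOf R L) : L) *
      algebraMap (CompletedField R F₁) L (algebraMap F₁ (CompletedField R F₁)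
        (algebraMap R F₁ π)) ^ m

/-- `IsRamification R F₁ D χ` says that `χ = ram_R([D])`, for a finite-dimensional central simple
algebra `D` over the fraction field `F₁` of `R`.

Write `F̂` for the completion of `F₁` and `k` for the residue field of `R`. Let `L/F̂` be a finite
unramified Galois extension, with group `G`, that splits `D ⊗ F̂`, so that
`[D ⊗ F̂] ∈ Br(L/F̂) = H²(G, Lˣ)` is the class of a crossed product with some cocycle `f`.
The image of this class under
`H²(G, Lˣ) → H²(G, ℤ) ≅ H¹(G, ℚ/ℤ) → H¹(k, ℚ/ℤ)`
is `χ`. Here the first map is induced by the valuation `v` of `L`; the second map is the inverse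
of the connecting homomorphism of `0 → ℤ → ℚ → ℚ/ℤ → 0`, so that the class of `v ∘ f` goes to
`g mod ℤ` whenever `g : G → ℚ` satisfies `g σ + g τ - g (στ) = v (f (σ, τ))`; and the
third map is inflation along the map from the absolute Galois group of `k` to `G`, which comes
from an embedding `φ`, over `k`, of the residue field of `L` into an algebraic closure of `k`:
`σ` is the image of `s` when `φ ∘ σ = s ∘ φ`.

The map is thus defined on the classes that are split by a finite unramified extension of `F̂`.
These include all classes whose order is prime to the characteristic of `k`. -/
def IsRamification (D : Type*) [Ring D] [Algebra F₁ D]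
    (χ : CharacterGroup (IsLocalRing.ResidueField R)) : Prop :=
  ∃ (L : IntermediateField (CompletedField R F₁) (AlgebraicClosure (CompletedField R F₁)))
    (_ : FiniteDimensional (CompletedField R F₁) L) (_ : IsGalois (CompletedField R F₁) L)
    (f : GaloisCocycle (CompletedField R F₁) L)
    (g : Gal(L/(CompletedField R F₁)) → ℚ)
    (φ : IntegersOf R L →+* AlgebraicClosure (IsLocalRing.ResidueField R)),
    Algebra.FormallyUnramified (CompletedRing R F₁) (IntegersOf R L) ∧
    BrauerEquivalent (CompletedField R F₁) (CompletedField R F₁ ⊗[F₁] D) (CrossedProduct f) ∧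
    (∀ σ τ, ∃ m : ℤ, HasValuation R L (f.1 (σ, τ) : L) m ∧ g σ + g τ - g (σ * τ) = m) ∧
    (∀ r : R, φ (algebraMap (CompletedRing R F₁) (IntegersOf R L)
        (algebraMap R (CompletedRing R F₁) r)) =
      algebraMap (IsLocalRing.ResidueField R) _ (IsLocalRing.residue R r)) ∧
    ∀ (s : Gal(AlgebraicClosure (IsLocalRing.ResidueField R)/IsLocalRing.ResidueField R))
      (σ : Gal(L/(CompletedField R F₁))),
      (∀ b b' : IntegersOf R L, (b' : L) = σ (b : L) → φ b' = s (φ b)) →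
        χ.1 s = Multiplicative.ofAdd ((g σ : ℚ) : AddCircle (1 : ℚ))

/-- `D/F₁` is ramified at `R`: `ram_R([D])` is nontrivial. -/
def IsRamifiedAt (D : Type*) [Ring D] [Algebra F₁ D] : Prop :=
  ∃ χ, IsRamification R F₁ D χ ∧ χ ≠ 1

/-- `D/F₁` has degree `n`: its dimension is `n²`. -/
def HasDegree (F₁ D : Type*) [Field F₁] [Ring D] [Algebra F₁ D] (n : ℕ) : Prop :=
  Module.finrank F₁ D = n ^ 2

/-- `D/F₁` is totally ramified at `R`: the order of `ram_R([D])` is the degree of `D/F₁`. -/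
def IsTotallyRamifiedAt (D : Type*) [Ring D] [Algebra F₁ D] : Prop :=
  ∃ χ, IsRamification R F₁ D χ ∧ HasDegree F₁ D (orderOf χ)

end Ramification

universe u

open WithZero

/-! The plan is to give `D₁` a valuation `w` with a ring homomorphism `φ` from its valuation ring to
a commutative field `E`. This suffices (`isDomain_tensorProduct_of_valuation`). Since `Fˣ` is
divisible and the values are discrete, `F` lies in the valuation ring. Two nonzero tensors in `D₁ ⊗
D₂`, divided on the left and on the right respectively by a coordinate of largest value, come from
the valuation ring and have nonzero images in `E ⊗ D₂`. That ring has no zero divisors because `F`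
is algebraically closed (`noZeroDivisors_tensorProduct_of_isAlgClosed`).

The valuation comes from ramification. Let `n` be the degree of `D₁` and let `L/F̂` be unramified,
such that `F̂ ⊗ D₁` is Brauer equivalent to a crossed product of `L`. By Morita theory `F̂ ⊗ D₁`
acts from the right on an `n`-dimensional `L`-space `V`, commuting with semilinear maps `u_σ` that
multiply according to the cocycle (`BrauerEquivalent.exists_semilinear`). If `g` has coboundary `v ∘
f`, then `u_σ` has slope `g σ`: up to the factor `u_{σ^k}`, its `k`-th iterate is a scalar of value
`k (g σ)`, corrected by `g (σ^k)`. Determinants show that `n g` is integral; since `g` mod `ℤ`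
inflates to the ramification character, of order `n`, no smaller multiple is. Hence some scalar
multiple `x` of some `u_τ` has slope exactly `1 / n`.

A norm on `V` adapted to `x` takes values in different classes modulo the value group of `L` on the
lines through `m, x m, …, x^(n-1) m`. These vectors therefore form a basis, and the norm of a
combination is the maximum of the norms of its terms. An endomorphism commuting with `x` scales this
norm by a constant, which defines `w`. The coefficient of `m` in the image of `m`, taken in the
residue field of `L`, defines `φ` (`isDomain_tensorProduct_of_slope`).

In prime degree `p`, the same determinant argument shows that the character is killed by `p`; so
nontrivial ramification is total. -/

/-! ### Tensor products over an algebraically closed field -/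

/-- Nullstellensatz, applied to the localization of `B` at `h`: a residue field of it is finite over
`F`, hence equal to `F`, and `h` becomes a unit there. -/
theorem exists_algHom_apply_ne_zero (F : Type*) {B : Type*} [Field F] [IsAlgClosed F] [CommRing B]
    [IsDomain B] [Algebra F B] [Algebra.FiniteType F B] {h : B} (hh : h ≠ 0) :
    ∃ θ : B →ₐ[F] F, θ h ≠ 0 := by
  let C := Localization.Away h
  have : Nontrivial C := not_subsingleton_iff_nontrivial.mp fun h0 => by
    obtain ⟨n, hn⟩ := (IsLocalization.subsingleton_iff (S := C) (M := Submonoid.powers h)).mp h0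
    exact pow_ne_zero n hh hn
  have : Algebra.FiniteType B C := IsLocalization.finiteType_of_monoid_fg (Submonoid.powers h) C
  have : Algebra.FiniteType F C := Algebra.FiniteType.trans (S := B) inferInstance inferInstance
  obtain ⟨m, hm⟩ := Ideal.exists_maximal C
  let _ : Field (C ⧸ m) := Ideal.Quotient.field m
  have : Module.Finite F (C ⧸ m) := finite_of_finite_type_of_isJacobsonRing F (C ⧸ m)
  let e : F ≃ₐ[F] (C ⧸ m) := AlgEquiv.ofBijective (Algebra.ofId F (C ⧸ m))
    (IsAlgClosed.algebraMap_bijective_of_isIntegral)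
  refine ⟨(e.symm : (C ⧸ m) →ₐ[F] F).comp
    ((Ideal.Quotient.mkₐ F m).comp (IsScalarTower.toAlgHom F B C)), ?_⟩
  have : IsUnit (algebraMap B C h) := IsLocalization.Away.algebraMap_isUnit h
  exact (this.map ((e.symm : (C ⧸ m) →ₐ[F] F).comp (Ideal.Quotient.mkₐ F m))).ne_zero

namespace TensorProduct

theorem equivFinsuppOfBasisRight_rTensor {R M M' N κ : Type*} [CommRing R] [AddCommGroup M]
    [AddCommGroup M'] [AddCommGroup N] [Module R M] [Module R M'] [Module R N]
    [DecidableEq κ] (b : Module.Basis κ R N) (f : M →ₗ[R] M') (x : M ⊗[R] N) (i : κ) :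
    equivFinsuppOfBasisRight b (f.rTensor N x) i = f (equivFinsuppOfBasisRight b x i) := by
  induction x with
  | zero => simp
  | add x y hx hy => simp [hx, hy]
  | tmul m n => simp

/-- A tensor is in the image of `B ⊗ N` as soon as its coordinates are in `B`. -/
theorem exists_rTensor_eq {R M N κ B : Type*} [CommRing R] [AddCommGroup M]
    [AddCommGroup N] [AddCommGroup B] [Module R M] [Module R N] [Module R B] [DecidableEq κ]
    (b : Module.Basis κ R N) (f : B →ₗ[R] M) (x : M ⊗[R] N)
    (h : ∀ i, equivFinsuppOfBasisRight b x i ∈ LinearMap.range f) :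
    ∃ y : B ⊗[R] N, f.rTensor N y = x := by
  choose c hc using h
  refine ⟨(equivFinsuppOfBasisRight b x).sum fun i _ => c i ⊗ₜ b i, ?_⟩
  conv_rhs => rw [← (equivFinsuppOfBasisRight b).symm_apply_apply x,
    equivFinsuppOfBasisRight_symm_apply]
  simp only [Finsupp.sum, map_sum, LinearMap.rTensor_tmul, hc]

theorem rTensor_mulLeft {R A B : Type*} [CommRing R] [Ring A] [Ring B] [Algebra R A] [Algebra R B]
    (a : A) (x : A ⊗[R] B) : (LinearMap.mulLeft R a).rTensor B x = a ⊗ₜ 1 * x := by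
  induction x with
  | zero => simp
  | add x y hx hy => rw [map_add, mul_add, hx, hy]
  | tmul m n => simp

theorem rTensor_mulRight {R A B : Type*} [CommRing R] [Ring A] [Ring B] [Algebra R A] [Algebra R B]
    (a : A) (x : A ⊗[R] B) : (LinearMap.mulRight R a).rTensor B x = x * a ⊗ₜ 1 := by
  induction x with
  | zero => simp
  | add x y hx hy => rw [map_add, add_mul, hx, hy]
  | tmul m n => simp

end TensorProduct

open TensorProduct in
/-- Over an algebraically closed field, the tensor product of a commutative domain and an
arbitrary algebra without zero divisors has no zero divisors. -/
theorem noZeroDivisors_tensorProduct_of_isAlgClosed (F E D : Type*) [Field F] [IsAlgClosed F]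
    [CommRing E] [IsDomain E] [Algebra F E] [Ring D] [NoZeroDivisors D] [Algebra F D] :
    NoZeroDivisors (E ⊗[F] D) := by
  classical
  refine ⟨fun {x y} hxy => ?_⟩
  by_contra! hne
  let b := Module.Basis.ofVectorSpace F D
  have key : ∀ z : E ⊗[F] D, z ≠ 0 → ∃ i, equivFinsuppOfBasisRight b z i ≠ 0 := by
    intro z hz
    by_contra! h
    exact hz ((equivFinsuppOfBasisRight b).map_eq_zero_iff.mp (Finsupp.ext h))
  obtain ⟨i, hi⟩ := key x hne.1
  obtain ⟨j, hj⟩ := key y hne.2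
  -- Spreading out: `x` and `y` are defined over the finitely generated subalgebra `B` that contains
  -- their coordinates, and `B` has enough `F`-points.
  let S : Finset E := (equivFinsuppOfBasisRight b x).frange ∪ (equivFinsuppOfBasisRight b y).frange
  let B := Algebra.adjoin F (S : Set E)
  have : Algebra.FiniteType F B := Subalgebra.fg_iff_finiteType _ |>.mp (Subalgebra.fg_adjoin_finset S)
  have hmem : ∀ z : E ⊗[F] D, (equivFinsuppOfBasisRight b z).frange ⊆ S → ∀ k,
      equivFinsuppOfBasisRight b z k ∈ LinearMap.range B.val.toLinearMap := by
    intro z hz k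
    rw [LinearMap.mem_range]
    by_cases hk : equivFinsuppOfBasisRight b z k = 0
    · exact ⟨0, by simp [hk]⟩
    · exact ⟨⟨_, Algebra.subset_adjoin (hz (Finsupp.mem_frange.mpr ⟨hk, k, rfl⟩))⟩, rfl⟩
  obtain ⟨x', hx'⟩ := exists_rTensor_eq b _ x (hmem x Finset.subset_union_left)
  obtain ⟨y', hy'⟩ := exists_rTensor_eq b _ y (hmem y Finset.subset_union_right)
  let Φ : B ⊗[F] D →ₐ[F] E ⊗[F] D := Algebra.TensorProduct.map B.val (AlgHom.id F D)
  have hΦinj : Function.Injective Φ :=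
    Module.Flat.rTensor_preserves_injective_linearMap B.val.toLinearMap Subtype.val_injective
  have hxy' : x' * y' = 0 := hΦinj (by
    rw [map_mul, map_zero]
    exact (congrArg₂ (· * ·) hx' hy').trans hxy)
  have hcoord : ∀ (z : B ⊗[F] D) k,
      equivFinsuppOfBasisRight b (Φ z) k = (equivFinsuppOfBasisRight b z k : E) :=
    fun z k => equivFinsuppOfBasisRight_rTensor b B.val.toLinearMap z k
  have hi' : equivFinsuppOfBasisRight b x' i ≠ 0 := fun h => hi (by
    rw [← hx']; exact (hcoord x' i).trans (by rw [h]; rfl))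
  have hj' : equivFinsuppOfBasisRight b y' j ≠ 0 := fun h => hj (by
    rw [← hy']; exact (hcoord y' j).trans (by rw [h]; rfl))
  -- Specialization at a point where one coordinate of each factor survives moves the problem to `F
  -- ⊗ D = D`.
  obtain ⟨θ, hθ⟩ := exists_algHom_apply_ne_zero F (mul_ne_zero hi' hj')
  let Ψ : B ⊗[F] D →ₐ[F] F ⊗[F] D := Algebra.TensorProduct.map θ (AlgHom.id F D)
  have hΨ : ∀ (z : B ⊗[F] D) k,
      equivFinsuppOfBasisRight b (Ψ z) k = θ (equivFinsuppOfBasisRight b z k) :=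
    fun z k => equivFinsuppOfBasisRight_rTensor b θ.toLinearMap z k
  have hΨ0 : ∀ (z : B ⊗[F] D) k, θ (equivFinsuppOfBasisRight b z k) ≠ 0 →
      Algebra.TensorProduct.lid F D (Ψ z) ≠ 0 := by
    intro z k hk h0
    rw [← hΨ, (Algebra.TensorProduct.lid F D).map_eq_zero_iff.mp h0] at hk
    simp at hk
  rw [map_mul] at hθ
  refine mul_ne_zero (hΨ0 x' i (left_ne_zero_of_mul hθ)) (hΨ0 y' j (right_ne_zero_of_mul hθ)) ?_
  rw [← map_mul, ← map_mul, hxy', map_zero, map_zero]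

open TensorProduct in
/-- If a division algebra over an algebraically closed field has a valuation whose valuation ring
contains the base field and maps to a field, then its tensor product with any division algebra is
a domain. -/
theorem isDomain_tensorProduct_of_valuation {F D E D' Γ : Type*} [Field F] [IsAlgClosed F]
    [DivisionRing D] [Algebra F D] [DivisionRing D'] [Algebra F D'] [Field E]
    [LinearOrderedCommGroupWithZero Γ] (w : Valuation D Γ)
    (hF : ∀ c : F, w (algebraMap F D c) ≤ 1) (φ : w.integer →+* E) :
    IsDomain (D ⊗[F] D') := by
  classical
  let O : Subalgebra F D := { w.integer with algebraMap_mem' := hF }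
  let _ : Algebra F E :=
    (φ.comp (algebraMap F O : F →+* w.integer)).toAlgebra
  let ψ : O →ₐ[F] E := { (φ : O →+* E) with commutes' := fun _ => rfl }
  have hw : ∀ d, w d ≤ 1 → d ∈ O := fun d h => h
  have := noZeroDivisors_tensorProduct_of_isAlgClosed F E D'
  let Φ : O ⊗[F] D' →ₐ[F] D ⊗[F] D' := Algebra.TensorProduct.map O.val (AlgHom.id F D')
  let Ψ : O ⊗[F] D' →ₐ[F] E ⊗[F] D' := Algebra.TensorProduct.map ψ (AlgHom.id F D')
  have hΦinj : Function.Injective Φ :=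
    Module.Flat.rTensor_preserves_injective_linearMap O.val.toLinearMap Subtype.val_injective
  let b := Module.Basis.ofVectorSpace F D'
  have hΦ : ∀ z k, equivFinsuppOfBasisRight b (Φ z) k = (equivFinsuppOfBasisRight b z k : D) :=
    fun z k => equivFinsuppOfBasisRight_rTensor b O.val.toLinearMap z k
  have hΨ : ∀ z k, equivFinsuppOfBasisRight b (Ψ z) k = ψ (equivFinsuppOfBasisRight b z k) :=
    fun z k => equivFinsuppOfBasisRight_rTensor b ψ.toLinearMap z k
  -- a coordinate of largest value
  have hmax : ∀ z : D ⊗[F] D', z ≠ 0 → ∃ i, equivFinsuppOfBasisRight b z i ≠ 0 ∧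
      ∀ k, w (equivFinsuppOfBasisRight b z k) ≤ w (equivFinsuppOfBasisRight b z i) := by
    intro z hz
    have hs : (equivFinsuppOfBasisRight b z).support.Nonempty := by
      rw [Finsupp.support_nonempty_iff]
      exact fun h => hz ((equivFinsuppOfBasisRight b).map_eq_zero_iff.mp h)
    obtain ⟨i, hi, h⟩ := Finset.exists_max_image _
      (fun k => w (equivFinsuppOfBasisRight b z k)) hs
    refine ⟨i, Finsupp.mem_support_iff.mp hi, fun k => ?_⟩
    by_cases hk : equivFinsuppOfBasisRight b z k = 0
    · simp [hk]
    · exact h k (Finsupp.mem_support_iff.mpr hk)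
  -- A coordinate equal to `1` is still `1` after `ψ`, so the reduction of the scaled tensor is
  -- nonzero. The map `f` is left or right multiplication by the inverse of a largest coordinate.
  have hlift : ∀ (z : D ⊗[F] D') (f : D →ₗ[F] D) i, f (equivFinsuppOfBasisRight b z i) = 1 →
      (∀ k, w (f (equivFinsuppOfBasisRight b z k)) ≤ 1) →
      ∃ z' : O ⊗[F] D', Φ z' = f.rTensor D' z ∧ Ψ z' ≠ 0 := by
    intro z f i hi hk
    obtain ⟨z', hz'⟩ := exists_rTensor_eq b O.val.toLinearMap (f.rTensor D' z) (fun k => by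
      rw [equivFinsuppOfBasisRight_rTensor]
      exact ⟨⟨_, hw _ (hk k)⟩, rfl⟩)
    refine ⟨z', hz', fun h0 => ?_⟩
    have h1 : equivFinsuppOfBasisRight b z' i = 1 := Subtype.ext (by
      rw [← hΦ, show Φ z' = f.rTensor D' z from hz', equivFinsuppOfBasisRight_rTensor, hi]
      rfl)
    have h2 := hΨ z' i
    rw [h1, h0, map_one, map_zero] at h2
    exact zero_ne_one h2
  have hNZD : NoZeroDivisors (D ⊗[F] D') := by
    refine ⟨fun {x y} hxy => ?_⟩
    by_contra! hne
    obtain ⟨i, hi, himax⟩ := hmax x hne.1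
    obtain ⟨j, hj, hjmax⟩ := hmax y hne.2
    set s := (equivFinsuppOfBasisRight b x i)⁻¹ with hs
    set t := (equivFinsuppOfBasisRight b y j)⁻¹ with ht
    obtain ⟨x', hx', hx0⟩ := hlift x (LinearMap.mulLeft F s) i (inv_mul_cancel₀ hi) (fun k => by
      rw [LinearMap.mulLeft_apply, map_mul, hs, map_inv₀]
      exact inv_mul_le_one_of_le₀ (himax k) zero_le)
    obtain ⟨y', hy', hy0⟩ := hlift y (LinearMap.mulRight F t) j (mul_inv_cancel₀ hj) (fun k => by
      rw [LinearMap.mulRight_apply, map_mul, ht, map_inv₀]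
      exact mul_inv_le_one_of_le₀ (hjmax k) zero_le)
    have hl : (LinearMap.mulLeft F s).rTensor D' x = s ⊗ₜ 1 * x := rTensor_mulLeft s x
    have hr : (LinearMap.mulRight F t).rTensor D' y = y * t ⊗ₜ 1 := rTensor_mulRight t y
    -- The factors `s` and `t` stand on the outer sides, so `x * y` remains intact in the middle.
    have : Φ (x' * y') = 0 := by
      rw [map_mul, hx', hy', hl, hr, mul_assoc, ← mul_assoc x, hxy, zero_mul, mul_zero]
    have h0 : x' * y' = 0 := hΦinj (by rw [this, map_zero])
    exact mul_ne_zero hx0 hy0 (by rw [← map_mul, h0, map_zero])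
  exact NoZeroDivisors.to_isDomain _

/-! ### Norms of slope `1 / n` on semilinear spaces -/

section Ultrametric

variable {V : Type*} [AddCommGroup V] {Γ : Type*} [LinearOrder Γ]

theorem ultrametric_add_eq_max {W : V → Γ} (hadd : ∀ u u', W (u + u') ≤ max (W u) (W u'))
    (hneg : ∀ u, W (-u) = W u) {a b : V} (h : W a ≠ W b) : W (a + b) = max (W a) (W b) := by
  wlog hlt : W a < W b generalizing a b
  · rw [add_comm, max_comm, this h.symm (lt_of_le_of_ne (not_lt.mp hlt) h.symm)]
  rw [max_eq_right hlt.le]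
  refine le_antisymm ((hadd a b).trans (max_le hlt.le le_rfl)) ?_
  by_contra! hc
  have h1 := hadd (a + b) (-a)
  rw [add_neg_cancel_comm, hneg] at h1
  exact absurd h1 (not_le.mpr (max_lt hc hlt))

theorem ultrametric_sum_eq_sup [OrderBot Γ] {W : V → Γ} (h0 : W 0 = ⊥)
    (hadd : ∀ u u', W (u + u') ≤ max (W u) (W u')) (hneg : ∀ u, W (-u) = W u)
    {ι : Type*} (s : Finset ι) (f : ι → V)
    (hf : ∀ i j, i ≠ j → W (f i) = W (f j) → W (f i) = ⊥) :
    W (∑ i ∈ s, f i) = s.sup (fun i => W (f i)) := by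
  classical
  induction s using Finset.induction_on with
  | empty => simpa using h0
  | insert a s ha ih =>
    rw [Finset.sum_insert ha, Finset.sup_insert, ← ih]
    by_cases h : W (f a) = W (∑ i ∈ s, f i)
    · have hb : W (f a) = ⊥ := by
        rcases s.eq_empty_or_nonempty with rfl | hs
        · rw [h, Finset.sum_empty, h0]
        · obtain ⟨i, hi, hi'⟩ := Finset.exists_mem_eq_sup s hs (fun i => W (f i))
          rw [ih, hi'] at h
          exact hf a i (fun hai => ha (hai ▸ hi)) h
      refine le_antisymm (hadd _ _) ?_
      rw [← h, hb]
      simp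
    · exact ultrametric_add_eq_max hadd hneg h

end Ultrametric

/-- A norm of slope `1 / n` on a vector space with a semilinear endomorphism `x`: with respect to
a discrete valuation `v`, the `n`-th power of the norm scales by `v` and `x` has value `1 / n`. -/
structure SlopeNorm {L V : Type*} [Field L] [AddCommGroup V] [Module L V]
    (v : Valuation L ℤᵐ⁰) (n : ℕ) (x : V → V) where
  /-- The `n`-th power of the norm. -/
  toFun : V → ℤᵐ⁰
  eq_zero : ∀ u, toFun u = 0 → u = 0
  map_add : ∀ u u', toFun (u + u') ≤ max (toFun u) (toFun u')
  map_smul : ∀ (a : L) u, toFun (a • u) = v a ^ n * toFun u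
  map_apply : ∀ u, toFun (x u) = exp (-1) * toFun u

section SlopeNorm

variable {L V : Type*} [Field L] [AddCommGroup V] [Module L V] {v : Valuation L ℤᵐ⁰}

theorem iterate_smul {τ : L →+* L} (x : V →ₛₗ[τ] V) (k : ℕ) (a : L) (u : V) :
    x^[k] (a • u) = τ^[k] a • x^[k] u := by
  induction k generalizing a u with
  | zero => rfl
  | succ k ih => rw [Function.iterate_succ_apply, map_smulₛₗ, ih]; rfl

theorem iterate_add {τ : L →+* L} (x : V →ₛₗ[τ] V) (k : ℕ) (u u' : V) :
    x^[k] (u + u') = x^[k] u + x^[k] u' := by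
  induction k generalizing u u' with
  | zero => rfl
  | succ k ih => rw [Function.iterate_succ_apply, map_add, ih]; rfl

theorem valuation_iterate {τ : L →+* L} (hτ : ∀ a, v (τ a) = v a) (k : ℕ) (a : L) :
    v (τ^[k] a) = v a := by
  induction k generalizing a with
  | zero => rfl
  | succ k ih => rw [Function.iterate_succ_apply, ih, hτ]

/-- The maximum of the values of the coordinates in any basis. -/
theorem exists_ultrametric_norm [FiniteDimensional L V] (v : Valuation L ℤᵐ⁰) :
    ∃ N : V → ℤᵐ⁰, (∀ u, N u = 0 → u = 0) ∧ (∀ u u', N (u + u') ≤ max (N u) (N u')) ∧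
      ∀ (a : L) u, N (a • u) = v a * N u := by
  let b := Module.finBasis L V
  refine ⟨fun u => Finset.univ.sup fun i => v (b.repr u i), fun u hu => ?_, fun u u' => ?_,
    fun a u => ?_⟩
  · refine b.ext_elem fun i => ?_
    have : v (b.repr u i) ≤ 0 :=
      (Finset.le_sup (f := fun i => v (b.repr u i)) (Finset.mem_univ i)).trans hu.le
    simpa using this
  · refine Finset.sup_le fun i _ => ?_
    rw [map_add, Finsupp.add_apply]
    exact (v.map_add _ _).trans (max_le_max
      (Finset.le_sup (f := fun i => v (b.repr u i)) (Finset.mem_univ i))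
      (Finset.le_sup (f := fun i => v (b.repr u' i)) (Finset.mem_univ i)))
  · by_cases ha : a = 0
    · simp only [ha, zero_smul, map_zero, Finsupp.coe_zero, Pi.zero_apply, zero_mul]
      exact le_antisymm (Finset.sup_le fun i _ => le_rfl) zero_le
    · have hva : 0 < v a := zero_lt_iff.mpr ((Valuation.ne_zero_iff v).mpr ha)
      simp only [map_smul, Finsupp.smul_apply, smul_eq_mul, map_mul]
      refine le_antisymm (Finset.sup_le fun i _ => ?_) ?_
      · exact mul_le_mul_right (Finset.le_sup (f := fun i => v (b.repr u i)) (Finset.mem_univ i)) _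
      · rw [← le_div_iff₀' hva]
        refine Finset.sup_le fun i _ => ?_
        rw [le_div_iff₀' hva]
        exact Finset.le_sup (f := fun i => v a * v (b.repr u i)) (Finset.mem_univ i)

/-- Any ultrametric norm is averaged, by a maximum, over the iterates of `x`, the `k`-th one being
compensated by `exp k`. As `x^(n s)` is a scalar of value `s`, the compensated `n`-th powers are
periodic in `k`, and so one period suffices for the maximum. Working with `n`-th powers keeps the
values in `ℤᵐ⁰`. -/
theorem exists_slopeNorm [FiniteDimensional L V] {τ : L →+* L} (hτ : ∀ a, v (τ a) = v a)
    (x : V →ₛₗ[τ] V) {n s : ℕ} (hn : 0 < n) (hs : 0 < s) {y : L} (hy : v y = exp (-(s : ℤ)))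
    (hx : ∀ u, x^[n * s] u = y • u) : Nonempty (SlopeNorm v n x) := by
  obtain ⟨N, hN0, hNadd, hNsmul⟩ := exists_ultrametric_norm (V := V) v
  have hm : 0 < n * s := Nat.mul_pos hn hs
  let t : V → ℕ → ℤᵐ⁰ := fun u k => N (x^[k] u) ^ n * exp (k : ℤ)
  let W : V → ℤᵐ⁰ := fun u => (Finset.range (n * s)).sup (t u)
  have hper : ∀ u, Function.Periodic (t u) (n * s) := by
    intro u k
    simp only [t]
    rw [add_comm k, Function.iterate_add_apply, hx, hNsmul, hy, mul_pow, ← exp_nsmul,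
      mul_comm (exp _), mul_assoc, ← exp_add]
    congr 2
    push_cast
    simp
  have hle : ∀ u c, W u ≤ c ↔ ∀ k, t u k ≤ c := by
    intro u c
    refine ⟨fun h k => ?_, fun h => Finset.sup_le fun k _ => h k⟩
    rw [← (hper u).map_mod_nat k]
    exact (Finset.le_sup (Finset.mem_range.mpr (Nat.mod_lt k hm))).trans h
  have hself : ∀ u k, t u k ≤ W u := fun u => (hle u _).mp le_rfl
  refine ⟨⟨W, fun u hu => ?_, fun u u' => ?_, fun a u => ?_, fun u => ?_⟩⟩
  · have h0 := (hself u 0).trans hu.le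
    simp only [t, Function.iterate_zero, id_eq, Nat.cast_zero, exp_zero, mul_one, le_zero_iff] at h0
    exact hN0 u (eq_zero_of_pow_eq_zero h0)
  · rw [hle]
    intro k
    have h1 : N (x^[k] (u + u')) ≤ max (N (x^[k] u)) (N (x^[k] u')) := by
      rw [iterate_add]
      exact hNadd _ _
    rcases le_max_iff.mp h1 with h | h
    · exact le_max_of_le_left ((mul_le_mul_left (pow_le_pow_left₀ zero_le h n) _).trans (hself u k))
    · exact le_max_of_le_right
        ((mul_le_mul_left (pow_le_pow_left₀ zero_le h n) _).trans (hself u' k))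
  · have ht : ∀ k, t (a • u) k = v a ^ n * t u k := fun k => by
      simp only [t]
      rw [iterate_smul, hNsmul, valuation_iterate hτ, mul_pow, mul_assoc]
    by_cases ha : v a = 0
    · rw [ha, zero_pow hn.ne', zero_mul, ← le_zero_iff, hle]
      intro k
      rw [ht, ha, zero_pow hn.ne', zero_mul]
    · have hva : 0 < v a ^ n := pow_pos (zero_lt_iff.mpr ha) n
      refine le_antisymm ?_ ?_
      · rw [hle]
        intro k
        rw [ht]
        exact mul_le_mul_right (hself u k) _
      · rw [← le_div_iff₀' hva, hle]
        intro k
        rw [le_div_iff₀' hva, ← ht]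
        exact hself _ k
  · have ht : ∀ k, t (x u) k = exp (-1) * t u (k + 1) := fun k => by
      simp only [t]
      rw [Function.iterate_succ_apply, mul_left_comm, ← exp_add]
      congr 2
      push_cast
      ring
    refine le_antisymm ?_ ?_
    · rw [hle]
      intro k
      rw [ht]
      exact mul_le_mul_right (hself u _) _
    · rw [← le_div_iff₀' exp_pos, hle]
      intro k
      rw [le_div_iff₀' exp_pos]
      -- By periodicity, `k = 0` also has a predecessor.
      obtain ⟨j, hj⟩ : ∃ j, t u k = t u (j + 1) := by
        refine ⟨k + (n * s - 1), ?_⟩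
        rw [← hper u k]
        congr 1
        omega
      rw [hj, ← ht]
      exact hself _ j

namespace SlopeNorm

variable {n : ℕ} {τ : L →+* L} {x : V →ₛₗ[τ] V}

theorem map_zero [NeZero n] (W : SlopeNorm v n x) : W.toFun 0 = 0 := by
  have := W.map_smul 0 0
  rwa [zero_smul, _root_.map_zero, zero_pow (NeZero.ne n), zero_mul] at this

theorem map_neg (W : SlopeNorm v n x) (u : V) : W.toFun (-u) = W.toFun u := by
  have := W.map_smul (-1) u
  rwa [neg_one_smul, Valuation.map_neg, _root_.map_one, one_pow, one_mul] at this

theorem map_iterate (W : SlopeNorm v n x) (k : ℕ) (u : V) : W.toFun (x^[k] u) = exp (-(k : ℤ)) * W.toFun u := by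
  induction k generalizing u with
  | zero => simp
  | succ k ih =>
    rw [Function.iterate_succ_apply, ih, W.map_apply, ← mul_assoc, ← exp_add]
    congr 2
    push_cast
    ring

theorem pow_mul_exp_ne_one {a : L} {i : ℕ} (hi : 0 < i) (hin : i < n) :
    v a ^ n * exp (-(i : ℤ)) ≠ 1 := by
  intro h
  have ha : v a ≠ 0 := fun h0 => by simp [h0, (hi.trans hin).ne'] at h
  rw [← exp_log ha, ← exp_nsmul, ← exp_add, exp_eq_one, nsmul_eq_mul] at h
  have h1 : (n : ℤ) ∣ i := ⟨log (v a), by linarith⟩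
  exact absurd (Nat.le_of_dvd hi (Int.natCast_dvd_natCast.mp h1)) (not_le.mpr hin)

/-- Up to the common factor `W m`, the `i`-th term has exponent `n log (v (a i)) - i`. These are
distinct modulo `n` for `0 ≤ i < n`, so no cancellation can occur. The factor in front depends only
on the coefficients and not on `m`. -/
theorem map_sum (W : SlopeNorm v n x) [NeZero n] (a : Fin n → L) (m : V) :
    W.toFun (∑ i : Fin n, a i • x^[i] m) =
      (Finset.univ.sup fun i => v (a i) ^ n * exp (-((i : ℕ) : ℤ))) * W.toFun m := by
  by_cases hm : W.toFun m = 0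
  · obtain rfl := W.eq_zero m hm
    have : ∀ k, x^[k] (0 : V) = 0 := fun k => by
      induction k with
      | zero => rfl
      | succ k ih => rw [Function.iterate_succ_apply, _root_.map_zero, ih]
    simp [this, W.map_zero]
  have hterm : ∀ i : Fin n, W.toFun (a i • x^[i] m) =
      v (a i) ^ n * exp (-((i : ℕ) : ℤ)) * W.toFun m := fun i => by
    rw [W.map_smul, W.map_iterate, mul_assoc]
  rw [ultrametric_sum_eq_sup (W := W.toFun) W.map_zero W.map_add W.map_neg]
  · simp only [hterm]
    refine le_antisymm (Finset.sup_le fun i hi => ?_) ?_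
    · exact mul_le_mul_left
        (Finset.le_sup (f := fun i : Fin n => v (a i) ^ n * exp (-((i : ℕ) : ℤ))) hi) _
    · rw [← le_div_iff₀ (zero_lt_iff.mpr hm)]
      refine Finset.sup_le fun i hi => ?_
      rw [le_div_iff₀ (zero_lt_iff.mpr hm)]
      exact Finset.le_sup
        (f := fun i : Fin n => v (a i) ^ n * exp (-((i : ℕ) : ℤ)) * W.toFun m) hi
  · intro i j hij h
    by_contra h0
    rw [hterm, hterm, mul_left_inj' hm] at h
    have hi : v (a i) ≠ 0 := fun hi => h0 (by
      rw [hterm, hi, zero_pow (NeZero.ne n), zero_mul, zero_mul]; rfl)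
    have hj : v (a j) ≠ 0 := fun hj => by
      rw [hj, zero_pow (NeZero.ne n), zero_mul] at h
      exact mul_ne_zero (pow_ne_zero n hi) exp_ne_zero h
    rw [← exp_log hi, ← exp_log hj, ← exp_nsmul, ← exp_nsmul, ← exp_add, ← exp_add, exp_inj,
      nsmul_eq_mul, nsmul_eq_mul] at h
    have h1 : (i : ℕ) ≡ j [MOD n] := by
      rw [← Int.natCast_modEq_iff]
      exact (Int.modEq_iff_dvd.mpr ⟨log (v (a j)) - log (v (a i)), by linarith⟩)
    exact hij (Fin.ext (Nat.ModEq.eq_of_lt_of_lt h1 i.2 j.2))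

theorem linearIndependent (W : SlopeNorm v n x) [NeZero n] {m : V} (hm : m ≠ 0) :
    LinearIndependent L (fun i : Fin n => x^[i] m) := by
  rw [Fintype.linearIndependent_iff]
  intro a ha i
  have h := W.map_sum a m
  rw [ha, W.map_zero] at h
  have h0 := (mul_eq_zero.mp h.symm).resolve_right fun h => hm (W.eq_zero m h)
  have h1 := (Finset.le_sup (f := fun i : Fin n => v (a i) ^ n * exp (-((i : ℕ) : ℤ)))
    (Finset.mem_univ i)).trans h0.le
  rw [le_zero_iff, mul_eq_zero] at h1
  simpa using eq_zero_of_pow_eq_zero (h1.resolve_right exp_ne_zero)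

/-- The basis `m, x m, …, x ^ (n - 1) m` of an `n`-dimensional space. -/
noncomputable def basis (W : SlopeNorm v n x) [NeZero n] (hn : Module.finrank L V = n) {m : V} (hm : m ≠ 0) :
    Module.Basis (Fin n) L V :=
  basisOfLinearIndependentOfCardEqFinrank (W.linearIndependent hm) (by simp [hn])

theorem basis_apply (W : SlopeNorm v n x) [NeZero n] (hn : Module.finrank L V = n) {m : V} (hm : m ≠ 0) (i : Fin n) :
    W.basis hn hm i = x^[i] m := by simp [basis]

theorem repr_self (W : SlopeNorm v n x) [NeZero n] (hn : Module.finrank L V = n) {m : V}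
    (hm : m ≠ 0) (i : Fin n) : (W.basis hn hm).repr m i = if i = 0 then 1 else 0 := by
  have h := (W.basis hn hm).repr_self_apply 0 i
  rw [W.basis_apply] at h
  simpa [eq_comm] using h

theorem sum_repr (W : SlopeNorm v n x) [NeZero n] (hn : Module.finrank L V = n) {m : V} (hm : m ≠ 0) (u : V) :
    ∑ i : Fin n, (W.basis hn hm).repr u i • x^[i] m = u := by
  simpa only [basis_apply] using (W.basis hn hm).sum_repr u

/-- A linear map that commutes with `x` scales the norm. -/
theorem map_commuting_mul (W : SlopeNorm v n x) [NeZero n] (hn : Module.finrank L V = n) {m : V} (hm : m ≠ 0)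
    (d : Module.End L V) (hd : ∀ u, d (x u) = x (d u)) (u : V) :
    W.toFun (d u) * W.toFun m = W.toFun (d m) * W.toFun u := by
  have hd' : ∀ k, d (x^[k] m) = x^[k] (d m) := fun k => by
    induction k with
    | zero => rfl
    | succ k ih => rw [Function.iterate_succ_apply', Function.iterate_succ_apply', hd, ih]
  rw [← W.sum_repr hn hm u, _root_.map_sum]
  simp only [_root_.map_smul, hd']
  -- `u` and `d u` have the same coefficients, with respect to the iterates of `m` and of `d m`;
  -- hence the same factor occurs on both sides.
  rw [W.map_sum, W.map_sum]
  exact mul_right_comm _ _ _ |>.trans (mul_comm _ _)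

theorem repr_zero_le (W : SlopeNorm v n x) [NeZero n] (hn : Module.finrank L V = n) {m : V} (hm : m ≠ 0) {u : V}
    (hu : W.toFun u ≤ W.toFun m) : v ((W.basis hn hm).repr u 0) ≤ 1 := by
  have hm' : 0 < W.toFun m := zero_lt_iff.mpr fun h => hm (W.eq_zero m h)
  rw [← W.sum_repr hn hm u, W.map_sum, mul_le_iff_le_one_left hm'] at hu
  have := (Finset.le_sup (f := fun i : Fin n =>
    v ((W.basis hn hm).repr u i) ^ n * exp (-((i : ℕ) : ℤ))) (Finset.mem_univ 0)).trans hu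
  simpa [pow_le_one_iff (NeZero.ne n)] using this

/-- For `0 < i < n` the exponent of the `i`-th term is not divisible by `n`, so its factor is never
`1`. Only the coefficient of `m` can attain the norm of `m`. This is what makes that coefficient,
modulo the maximal ideal, a multiplicative invariant. -/
theorem sub_smul_lt_iff (W : SlopeNorm v n x) [NeZero n] (hn : Module.finrank L V = n) {m : V} (hm : m ≠ 0) {u : V}
    (hu : W.toFun u ≤ W.toFun m) (c : L) :
    W.toFun (u - c • m) < W.toFun m ↔ v ((W.basis hn hm).repr u 0 - c) < 1 := by
  have hm' : 0 < W.toFun m := zero_lt_iff.mpr fun h => hm (W.eq_zero m h)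
  have hrepr : ∀ i : Fin n, (W.basis hn hm).repr (u - c • m) i =
      if i = 0 then (W.basis hn hm).repr u 0 - c else (W.basis hn hm).repr u i := by
    intro i
    rw [map_sub, _root_.map_smul, Finsupp.sub_apply, Finsupp.smul_apply, W.repr_self]
    split_ifs with h
    · simp [h]
    · simp
  rw [← W.sum_repr hn hm u, W.map_sum, mul_le_iff_le_one_left hm'] at hu
  rw [← W.sum_repr hn hm (u - c • m), W.map_sum, mul_lt_iff_lt_one_left hm',
    Finset.sup_lt_iff (by exact one_pos)]
  constructor
  · intro h
    have := h 0 (Finset.mem_univ 0)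
    rw [hrepr, if_pos rfl] at this
    simpa [pow_lt_one_iff (NeZero.ne n)] using this
  · intro h i _
    rw [hrepr]
    split_ifs with hi
    · subst hi
      simpa [pow_lt_one_iff (NeZero.ne n)] using h
    · refine lt_of_le_of_ne ((Finset.le_sup (f := fun i : Fin n =>
        v ((W.basis hn hm).repr u i) ^ n * exp (-((i : ℕ) : ℤ))) (Finset.mem_univ i)).trans hu) ?_
      exact pow_mul_exp_ne_one (Nat.pos_of_ne_zero fun h => hi (Fin.ext h)) i.2

end SlopeNorm

end SlopeNorm

/-! ### The valuation and the residue map on the division algebra -/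

/-- The multiplicative group of an algebraically closed field is divisible, so that it has only
trivial values in `ℤ`. -/
theorem Valuation.map_algebraMap_le_one {F D : Type*} [Field F] [IsAlgClosed F] [Ring D]
    [Algebra F D] (w : Valuation D ℤᵐ⁰) (c : F) : w (algebraMap F D c) ≤ 1 := by
  by_contra! hc
  have h0 : w (algebraMap F D c) ≠ 0 := (zero_lt_one.trans hc).ne'
  set a := log (w (algebraMap F D c)) with ha
  have hpos : 0 < a := by
    rw [← exp_lt_exp, ha, exp_log h0, exp_zero]
    exact hc
  -- The exponent `a + 1` is chosen because it cannot divide `a > 0`.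
  obtain ⟨z, hz⟩ := IsAlgClosed.exists_pow_nat_eq c (n := a.toNat + 1) (Nat.succ_pos _)
  have hzp : w (algebraMap F D z) ^ (a.toNat + 1) = exp a := by
    rw [← map_pow, ← map_pow, hz, ha, exp_log h0]
  have hz0 : w (algebraMap F D z) ≠ 0 := fun h => by
    rw [h, zero_pow (Nat.succ_ne_zero _)] at hzp
    exact exp_ne_zero hzp.symm
  rw [← exp_log hz0, ← exp_nsmul, exp_inj, nsmul_eq_mul] at hzp
  have hdvd : ((a.toNat + 1 : ℕ) : ℤ) ∣ a := ⟨_, hzp.symm⟩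
  have := Int.le_of_dvd hpos hdvd
  omega

-- The value of `d` is the factor by which it scales the slope norm; its residue is the coefficient
-- of `m` in the image of `m`. Both depend on slope `1 / n` and dimension `n` matching exactly.
open MulOpposite in
theorem isDomain_tensorProduct_of_slope {F D D' L V : Type*} [Field F] [IsAlgClosed F]
    [DivisionRing D] [Algebra F D] [DivisionRing D'] [Algebra F D'] [Field L] [AddCommGroup V]
    [Module L V] {n s : ℕ} (hn : 0 < n) (hs : 0 < s) (hV : Module.finrank L V = n)
    (v : Valuation L ℤᵐ⁰) {τ : L →+* L} (hτ : ∀ a, v (τ a) = v a) (x : V →ₛₗ[τ] V)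
    {y : L} (hy : v y = exp (-(s : ℤ))) (hx : ∀ u, x^[n * s] u = y • u)
    (ρ : Dᵐᵒᵖ →+* Module.End L V) (hρ : ∀ d u, ρ d (x u) = x (ρ d u)) :
    IsDomain (D ⊗[F] D') := by
  have : NeZero n := ⟨hn.ne'⟩
  have : FiniteDimensional L V := Module.finite_of_finrank_pos (hV ▸ hn)
  have : Nontrivial V := Module.nontrivial_of_finrank_pos (hV ▸ hn)
  obtain ⟨W⟩ := exists_slopeNorm hτ x hn hs hy hx
  obtain ⟨m, hm⟩ := exists_ne (0 : V)
  have hWm : W.toFun m ≠ 0 := fun h => hm (W.eq_zero m h)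
  have hmul : ∀ d u, W.toFun (ρ d u) = W.toFun (ρ d m) / W.toFun m * W.toFun u := fun d u => by
    rw [div_mul_eq_mul_div, eq_div_iff hWm]
    exact W.map_commuting_mul hV hm (ρ d) (hρ d) u
  let w : Valuation D ℤᵐ⁰ :=
    { toFun := fun d => W.toFun (ρ (op d) m) / W.toFun m
      map_zero' := by simp [W.map_zero]
      map_one' := by simp [hWm]
      map_mul' := fun d d' => by
        rw [op_mul, map_mul, Module.End.mul_apply, hmul, mul_div_assoc, mul_comm]
      map_add_le_max' := fun d d' => by
        rw [op_add, map_add, LinearMap.add_apply]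
        rcases le_max_iff.mp (W.map_add (ρ (op d) m) (ρ (op d') m)) with h | h
        · exact le_max_of_le_left (div_le_div_of_nonneg_right h zero_le)
        · exact le_max_of_le_right (div_le_div_of_nonneg_right h zero_le) }
  have hw : ∀ d, w d ≤ 1 → W.toFun (ρ (op d) m) ≤ W.toFun m := fun d hd => by
    rwa [← div_le_one₀ (zero_lt_iff.mpr hWm)]
  let a : D → L := fun d => (W.basis hV hm).repr (ρ (op d) m) 0
  have ha : ∀ d : w.integer, v (a d) ≤ 1 := fun d => W.repr_zero_le hV hm (hw d d.2)
  have hlt : ∀ (d : w.integer) c, W.toFun (ρ (op d) m - c • m) < W.toFun m ↔ v (a d - c) < 1 :=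
    fun d c => W.sub_smul_lt_iff hV hm (hw d d.2) c
  let A : w.integer → v.valuationSubring := fun d => ⟨a d, ha d⟩
  have hres : ∀ b c : v.valuationSubring, v ((b : L) - c) < 1 →
      IsLocalRing.residue _ b = IsLocalRing.residue _ c := fun b c h => by
    rw [← sub_eq_zero, ← map_sub, IsLocalRing.residue_eq_zero_iff,
      Valuation.mem_maximalIdeal_iff]
    exact h
  let φ : w.integer →+* IsLocalRing.ResidueField v.valuationSubring :=
    { toFun := fun d => IsLocalRing.residue _ (A d)
      map_zero' := by
        rw [← map_zero (IsLocalRing.residue v.valuationSubring)]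
        exact congrArg _ (Subtype.ext (by simp [A, a]))
      map_one' := by
        rw [← map_one (IsLocalRing.residue v.valuationSubring)]
        refine congrArg _ (Subtype.ext ?_)
        change (W.basis hV hm).repr (ρ (op 1) m) 0 = 1
        rw [op_one, map_one, Module.End.one_apply]
        simp [W.repr_self]
      map_add' := fun d d' => by
        rw [← map_add]
        exact congrArg _ (Subtype.ext (by simp [A, a]))
      map_mul' := fun d d' => by
        rw [← map_mul]
        refine hres _ _ ?_
        change v (a ((d * d' : w.integer) : D) - a d * a d') < 1
        rw [← hlt]
        -- The error of multiplicativity splits into the error for `d`, moved by `d'`, and the error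
        -- for `d'`, scaled by `a d`. Both have norm below that of `m`.
        have : ρ (op ((d * d' : w.integer) : D)) m - (a d * a d') • m =
            ρ (op (d' : D)) (ρ (op (d : D)) m - a d • m) +
              a d • (ρ (op (d' : D)) m - a d' • m) := by
          rw [Subring.coe_mul, op_mul, map_mul, Module.End.mul_apply, map_sub, map_smul, smul_sub,
            mul_smul]
          abel
        rw [this]
        refine (W.map_add _ _).trans_lt (max_lt ?_ ?_)
        · rw [hmul]
          exact (mul_le_of_le_one_left' d'.2).trans_lt ((hlt d _).mpr (by simp))
        · rw [W.map_smul]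
          exact (mul_le_of_le_one_left' (pow_le_one₀ zero_le (ha d))).trans_lt
            ((hlt d' _).mpr (by simp)) }
  exact isDomain_tensorProduct_of_valuation w w.map_algebraMap_le_one φ

/-! ### From Brauer equivalence to semilinear maps -/

/-- A module over the matrix ring `Mat_b(A)` is `V ^ b` for an `A`-module `V`, functorially. -/
theorem exists_corner_module {K A W : Type*} [Field K] [Ring A] [Algebra K A] [AddCommGroup W]
    [Module K W] [FiniteDimensional K W] {b : ℕ} (hb : b ≠ 0)
    (Ψ : Matrix (Fin b) (Fin b) A →ₐ[K] Module.End K W) :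
    ∃ (V : Submodule K W) (Φ : A →ₐ[K] Module.End K V),
      (∀ a w, (Φ a w : W) = Ψ (Matrix.scalar (Fin b) a) w) ∧
      (∀ r : Module.End K W, (∀ M, Commute r (Ψ M)) → ∀ w ∈ V, r w ∈ V) ∧
      b * Module.finrank K V = Module.finrank K W := by
  classical
  have : NeZero b := ⟨hb⟩
  let E : Fin b → Fin b → Module.End K W := fun i j => Ψ (Matrix.single i j 1)
  have hE : ∀ i j k w, E i j (E j k w) = E i k w := fun i j k w => by
    rw [← Module.End.mul_apply, ← map_mul, Matrix.single_mul_single_same, mul_one]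
  have hE0 : ∀ i j k l w, j ≠ k → E i j (E k l w) = 0 := fun i j k l w h => by
    rw [← Module.End.mul_apply, ← map_mul, Matrix.single_mul_single_of_ne _ _ _ _ h, map_zero,
      LinearMap.zero_apply]
  have hsum : ∀ w, ∑ i, E i i w = w := fun w => by
    rw [← LinearMap.sum_apply, ← map_sum, Matrix.sum_single_one, map_one, Module.End.one_apply]
  -- The corner cut out by the idempotent `e₀₀`; the matrix units `e₀ᵢ` and `eᵢ₀` identify `W` with
  -- `V ^ b`.
  let V : Submodule K W := LinearMap.eqLocus (E 0 0) LinearMap.id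
  have hV : ∀ w, w ∈ V ↔ E 0 0 w = w := fun w => Iff.rfl
  have hcomm : ∀ r : Module.End K W, (∀ M, Commute r (Ψ M)) → ∀ w ∈ V, r w ∈ V := by
    intro r hr w hw
    rw [hV] at hw ⊢
    have := congrArg (· w) (hr (Matrix.single 0 0 1)).eq
    exact this.symm.trans (congrArg r hw)
  let S : A →ₐ[K] Module.End K W := Ψ.comp (Matrix.scalarAlgHom (Fin b) K)
  have hscalar : ∀ a : A, Commute (Matrix.scalar (Fin b) a) (Matrix.single 0 0 (1 : A)) := by
    intro a
    refine Matrix.ext fun i j => ?_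
    simp [Matrix.single_apply, Matrix.diagonal_mul, Matrix.mul_diagonal]
  have hS : ∀ a w, w ∈ V → S a w ∈ V := by
    intro a w hw
    rw [hV] at hw ⊢
    have := congrArg (· w) ((hscalar a).map Ψ).eq
    exact this.symm.trans (congrArg _ hw)
  let Φ : A →ₐ[K] Module.End K V :=
    { toFun := fun a => (S a).restrict (hS a)
      map_one' := LinearMap.ext fun w => Subtype.ext (by simp)
      map_mul' := fun a a' => LinearMap.ext fun w => Subtype.ext (by simp)
      map_zero' := LinearMap.ext fun w => Subtype.ext (by simp)
      map_add' := fun a a' => LinearMap.ext fun w => Subtype.ext (by simp)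
      commutes' := fun c => LinearMap.ext fun w => Subtype.ext (by simp) }
  refine ⟨V, Φ, fun a w => rfl, hcomm, ?_⟩
  let e : W ≃ₗ[K] (Fin b → V) :=
    { toFun := fun w i => ⟨E 0 i w, hE 0 0 i w⟩
      map_add' := fun w w' => by ext; simp
      map_smul' := fun c w => by ext; simp
      invFun := fun z => ∑ i, E i 0 (z i)
      left_inv := fun w => by simp [hE, hsum]
      right_inv := fun z => by
        ext i
        simp only [map_sum]
        rw [Finset.sum_eq_single i]
        · rw [hE]; exact (z i).2
        · intro j _ hj
          exact hE0 _ _ _ _ _ hj.symm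
        · simp }
  rw [e.finrank_eq, Module.finrank_pi_fintype]
  simp

/-- Brauer equivalence provides a bimodule of the expected dimension. -/
theorem BrauerEquivalent.exists_bimodule {K A : Type*} {C : Type u} [Field K] [Ring C] [Ring A] [Algebra K C]
    [Algebra K A] [FiniteDimensional K C] [FiniteDimensional K A] {n m : ℕ}
    (hC : Module.finrank K C = n ^ 2) (hA : Module.finrank K A = m ^ 2)
    (h : BrauerEquivalent K C A) :
    ∃ (V : Type u) (_ : AddCommGroup V) (_ : Module K V) (Φ : A →ₐ[K] Module.End K V)
      (ρ : Cᵐᵒᵖ →+* Module.End K V),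
      (∀ c a, Commute (ρ c) (Φ a)) ∧ Module.finrank K V = m * n := by
  obtain ⟨a, b, ha, hb, ⟨e⟩⟩ := h
  -- Columns `C ^ a` carry commuting actions of matrices on the left and of `C` on the right.
  -- Through `e` they become a module over matrices on `A`, whose corner is the bimodule.
  let Ψ₀ : Matrix (Fin a) (Fin a) C →ₐ[K] Module.End K (Fin a → C) :=
    { toFun := fun M => 
        { toFun := fun w => M.mulVec w
          map_add' := fun w w' => Matrix.mulVec_add M w w'
          map_smul' := fun c w => Matrix.mulVec_smul M c w }
      map_one' := LinearMap.ext fun w => by simp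
      map_mul' := fun M N => LinearMap.ext fun w => by simp
      map_zero' := LinearMap.ext fun w => by simp
      map_add' := fun M N => LinearMap.ext fun w => by simp [Matrix.add_mulVec]
      commutes' := fun c => LinearMap.ext fun w => funext fun i => by
        simp [Algebra.algebraMap_eq_smul_one, Matrix.smul_mulVec] }
  let ρ₀ : Cᵐᵒᵖ →+* Module.End K (Fin a → C) := Module.toModuleEnd K (Fin a → C)
  obtain ⟨V, Φ, hΦ, hV, hdim⟩ := exists_corner_module hb (Ψ₀.comp e.symm.toAlgHom)
  have hρ₀ : ∀ c M, Commute (ρ₀ c) (Ψ₀ M) := fun c M => by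
    refine LinearMap.ext fun w => ?_
    exact (Matrix.mulVec_smul M c w).symm
  let ρ : Cᵐᵒᵖ →+* Module.End K V :=
    { toFun := fun c => (ρ₀ c).restrict (hV (ρ₀ c) fun M => hρ₀ c _)
      map_one' := LinearMap.ext fun w => Subtype.ext (by simp)
      map_mul' := fun c c' => LinearMap.ext fun w => Subtype.ext (by simp)
      map_zero' := LinearMap.ext fun w => Subtype.ext (by simp)
      map_add' := fun c c' => LinearMap.ext fun w => Subtype.ext (by simp) }
  refine ⟨V, inferInstance, inferInstance, Φ, ρ, fun c x => ?_, ?_⟩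
  · refine LinearMap.ext fun w => Subtype.ext ?_
    rw [Module.End.mul_apply, Module.End.mul_apply, hΦ]
    change ρ₀ c (Φ x w) = _
    rw [hΦ]
    exact congrArg (· (w : Fin a → C)) (hρ₀ c _).eq
  · have h1 := e.toLinearEquiv.finrank_eq
    rw [Module.finrank_matrix, Module.finrank_matrix, hC, hA] at h1
    have hab : a * n = b * m := by
      refine Nat.pow_left_injective two_ne_zero ?_
      simp only [Fintype.card_fin] at h1
      linarith [h1, mul_pow a n 2, mul_pow b m 2]
    rw [Module.finrank_pi_fintype, Finset.sum_const, hC, Finset.card_univ, Fintype.card_fin,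
      smul_eq_mul, pow_two, ← mul_assoc, hab, mul_assoc] at hdim
    exact Nat.eq_of_mul_eq_mul_left (Nat.pos_of_ne_zero hb) hdim

namespace CrossedProduct

variable {K L : Type*} [Field K] [Field L] [Algebra K L] (f : GaloisCocycle K L)

open scoped Classical in
/-- The element `a u_σ` of the crossed product. -/
noncomputable def single (σ : Gal(L/K)) (a : L) : CrossedProduct f := ⟨Pi.single σ a⟩

theorem single_add (σ : Gal(L/K)) (a b : L) : single f σ (a + b) = single f σ a + single f σ b := by
  classical
  exact ext_coeff fun ρ => congrFun (Pi.single_add (f := fun _ => L) σ a b) ρ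

theorem single_zero (σ : Gal(L/K)) : single f σ 0 = 0 := by
  classical
  exact ext_coeff fun ρ => congrFun (Pi.single_zero (M := fun _ => L) σ) ρ

theorem single_one_inv : single f 1 (f.1 (1, 1) : L)⁻¹ = 1 := by
  classical
  refine ext_coeff fun ρ => ?_
  by_cases h : ρ = 1
  · subst h
    rw [coeff_one_one]
    simp [single]
  · rw [coeff_one_of_ne h]
    simp [single, Pi.single_eq_of_ne h]

variable [FiniteDimensional K L]

theorem single_mul_single (σ τ : Gal(L/K)) (a b : L) :
    single f σ a * single f τ b = single f (σ * τ) (a * σ b * f.1 (σ, τ)) := by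
  classical
  refine ext_coeff fun ρ => ?_
  rw [coeff_mul, Finset.sum_eq_single σ]
  · by_cases h : ρ = σ * τ
    · subst h
      simp [single]
    · have h' : σ⁻¹ * ρ ≠ τ := fun h' => h (by rw [← h', mul_inv_cancel_left])
      simp [single, Pi.single_eq_of_ne h, Pi.single_eq_of_ne h']
  · intro κ _ hκ
    simp [single, Pi.single_eq_of_ne hκ]
  · simp

/-- The embedding of `L` into the crossed product. -/
noncomputable def ofField : L →ₐ[K] CrossedProduct f where
  toFun a := single f 1 (a * (f.1 (1, 1) : L)⁻¹)
  map_one' := by rw [one_mul, single_one_inv]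
  map_mul' a b := by
    rw [single_mul_single, one_mul]
    congr 1
    simp only [AlgEquiv.one_apply]
    field_simp [(f.1 (1, 1)).ne_zero]
  map_zero' := by rw [zero_mul, single_zero]
  map_add' a b := by rw [add_mul, single_add]
  commutes' c := by
    classical
    rw [Algebra.algebraMap_eq_smul_one (A := CrossedProduct f), ← single_one_inv,
      ← Algebra.smul_def]
    exact ext_coeff fun ρ => congrFun (Pi.single_smul (f := fun _ => L) (1 : Gal(L/K)) c _) ρ

theorem ofField_mul_single (σ : Gal(L/K)) (a b : L) :
    ofField f a * single f σ b = single f σ (a * b) := by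
  refine (single_mul_single f 1 σ _ b).trans ?_
  rw [one_mul, cocycle_one_left f σ, AlgEquiv.one_apply]
  congr 1
  field_simp [(f.1 (1, 1)).ne_zero]

theorem single_mul_ofField (σ : Gal(L/K)) (a b : L) :
    single f σ b * ofField f a = single f σ (b * σ a) := by
  refine (single_mul_single f σ 1 b _).trans ?_
  rw [mul_one, cocycle_one_right f σ, map_mul, map_inv₀]
  congr 1
  have := (map_ne_zero σ).mpr (f.1 (1, 1)).ne_zero
  field_simp

/-- The crossed product as a vector space. -/
def coeffLinearEquiv : CrossedProduct f ≃ₗ[K] (Gal(L/K) → L) :=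
  { coeffEquiv f with
    map_add' := fun _ _ => rfl
    map_smul' := fun _ _ => rfl }

instance : FiniteDimensional K (CrossedProduct f) :=
  (coeffLinearEquiv f).symm.finiteDimensional

theorem finrank_eq [IsGalois K L] :
    Module.finrank K (CrossedProduct f) = Module.finrank K L ^ 2 := by
  rw [(coeffLinearEquiv f).finrank_eq, Module.finrank_pi_fintype, Finset.sum_const,
    Finset.card_univ, ← Nat.card_eq_fintype_card, IsGalois.card_aut_eq_finrank, smul_eq_mul,
    pow_two]

end CrossedProduct

/-- An algebra of degree `n` that is equivalent to a crossed product acts from the right on an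
`n`-dimensional `L`-space with compatible semilinear maps `u_σ`. -/
theorem BrauerEquivalent.exists_semilinear {K L : Type*} {C : Type u} [Field K] [Field L] [Algebra K L]
    [FiniteDimensional K L] [IsGalois K L] [Ring C] [Algebra K C] [FiniteDimensional K C]
    {f : GaloisCocycle K L} {n : ℕ} (hC : Module.finrank K C = n ^ 2)
    (h : BrauerEquivalent K C (CrossedProduct f)) :
    ∃ (V : Type u) (_ : AddCommGroup V) (_ : Module L V)
      (u : ∀ σ : Gal(L/K), V →ₛₗ[(σ : L →+* L)] V) (ρ : Cᵐᵒᵖ →+* Module.End L V),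
      Module.finrank L V = n ∧ (∀ w, u 1 w = (f.1 (1, 1) : L) • w) ∧
      (∀ σ τ w, u σ (u τ w) = (f.1 (σ, τ) : L) • u (σ * τ) w) ∧
      ∀ c σ w, ρ c (u σ w) = u σ (ρ c w) := by
  obtain ⟨V, hV₁, hV₂, Φ, ρ, hρ, hdim⟩ := h.exists_bimodule hC (CrossedProduct.finrank_eq f)
  let ι : L →ₐ[K] Module.End K V := Φ.comp (CrossedProduct.ofField f)
  let _ : Module L V := Module.compHom V (ι : L →+* Module.End K V)
  have hsmul : ∀ (a : L) (w : V), a • w = Φ (CrossedProduct.ofField f a) w := fun _ _ => rfl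
  have : IsScalarTower K L V := ⟨fun c a w => by
    rw [hsmul, hsmul, map_smul, map_smul, LinearMap.smul_apply]⟩
  let u : ∀ σ : Gal(L/K), V →ₛₗ[(σ : L →+* L)] V := fun σ =>
    { toFun := fun w => Φ (CrossedProduct.single f σ 1) w
      map_add' := fun w w' => map_add _ w w'
      map_smul' := fun a w => by
        rw [hsmul, hsmul, ← Module.End.mul_apply, ← Module.End.mul_apply, ← map_mul, ← map_mul,
          CrossedProduct.single_mul_ofField, CrossedProduct.ofField_mul_single, mul_comm]
        rfl }
  have hu : ∀ σ w, u σ w = Φ (CrossedProduct.single f σ 1) w := fun _ _ => rfl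
  let ρ' : Cᵐᵒᵖ →+* Module.End L V :=
    { toFun := fun c =>
        { toFun := ρ c
          map_add' := map_add _
          map_smul' := fun a w => congrArg (· w) (hρ c (CrossedProduct.ofField f a)).eq }
      map_one' := LinearMap.ext fun w => by simp
      map_mul' := fun c c' => LinearMap.ext fun w => congrArg (· w) (map_mul ρ c c')
      map_zero' := LinearMap.ext fun w => by simp
      map_add' := fun c c' => LinearMap.ext fun w => congrArg (· w) (map_add ρ c c') }
  refine ⟨V, hV₁, inferInstance, u, ρ', ?_, fun w => ?_, fun σ τ w => ?_, fun c σ w => ?_⟩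
  -- The crossed product has degree `[L : K]`, so `V` has dimension `[L : K] n` over `K`.
  · have := Module.finrank_mul_finrank K L V
    rw [hdim] at this
    exact Nat.eq_of_mul_eq_mul_left Module.finrank_pos this
  · rw [hu, hsmul]
    congr 2
    change _ = CrossedProduct.single f 1 _
    rw [mul_inv_cancel₀ (f.1 (1, 1)).ne_zero]
  · rw [hu, hu, hu, hsmul, ← Module.End.mul_apply, ← Module.End.mul_apply, ← map_mul, ← map_mul,
      CrossedProduct.single_mul_single, CrossedProduct.ofField_mul_single]
    simp
  · exact congrArg (· w) (hρ c (CrossedProduct.single f σ 1)).eq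

/-! ### Slopes of the semilinear maps -/

section Slopes

variable {G : Type*} [Group G]

/-- A function on a finite group with values in `ℚ` is determined by its coboundary. -/
theorem eq_of_coboundary_eq [Finite G] {g h : G → ℚ}
    (H : ∀ σ τ, g σ + g τ - g (σ * τ) = h σ + h τ - h (σ * τ)) : g = h := by
  funext σ
  have h1 : g 1 = h 1 := by simpa using H 1 1
  -- `g - h` is a homomorphism from a finite group to `ℚ`, hence zero.
  have hpow : ∀ k : ℕ, g (σ ^ k) - h (σ ^ k) = k * (g σ - h σ) := fun k => by
    induction k with
    | zero => simp [h1]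
    | succ k ih =>
      have := H (σ ^ k) σ
      rw [pow_succ]
      push_cast
      linarith
  have h2 := hpow (Nat.card G)
  rw [pow_card_eq_one', h1, sub_self, eq_comm, mul_eq_zero] at h2
  exact sub_eq_zero.mp (h2.resolve_left (Nat.cast_ne_zero.mpr Nat.card_pos.ne'))

/-- A function `g` with integral coboundary is a character modulo `ℤ`. If `n` is its exponent,
then it takes the value `1 / n` modulo `ℤ`. -/
theorem exists_eq_inv_of_exponent {g : G → ℚ} (hg : ∀ σ τ, ∃ m : ℤ, g σ + g τ - g (σ * τ) = m)
    {n : ℕ} (hn : 0 < n) (hint : ∀ σ, ∃ h : ℤ, n * g σ = h)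
    (hexp : ∀ d : ℕ, 0 < d → (∀ σ, ∃ h : ℤ, d * g σ = h) → n ≤ d) :
    ∃ (τ : G) (c : ℤ), n * (g τ + c) = 1 := by
  have hg1 : ∃ m : ℤ, g 1 = m := by simpa using hg 1 1
  -- The values of `n g`, taken modulo `n ℤ`, as a subgroup of `ℤ` containing `n`. If `a` generates
  -- it and `n = a e`, then `|e|` already clears all denominators of `g`; minimality of `n` forces
  -- `a = ±1`.
  let A : AddSubgroup ℤ :=
    { carrier := {h | ∃ (σ : G) (c : ℤ), n * (g σ + c) = h}
      zero_mem' := by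
        obtain ⟨m, hm⟩ := hg1
        exact ⟨1, -m, by simp [hm]⟩
      add_mem' := by
        rintro h h' ⟨σ, c, hc⟩ ⟨τ, c', hc'⟩
        obtain ⟨m, hm⟩ := hg σ τ
        refine ⟨σ * τ, c + c' + m, ?_⟩
        push_cast
        rw [← hc, ← hc', ← hm]
        ring
      neg_mem' := by
        rintro h ⟨σ, c, hc⟩
        obtain ⟨m, hm⟩ := hg σ σ⁻¹
        obtain ⟨m', hm'⟩ := hg1
        rw [mul_inv_cancel, hm'] at hm
        refine ⟨σ⁻¹, -m - m' - c, ?_⟩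
        push_cast
        rw [← hc]
        linear_combination (n : ℚ) * hm }
  have hA : ∀ h, h ∈ A ↔ ∃ (σ : G) (c : ℤ), n * (g σ + c) = h := fun h => Iff.rfl
  obtain ⟨a, ha⟩ := Int.subgroup_cyclic A
  have hdvd : ∀ h ∈ A, a ∣ h := fun h hh => by
    rw [ha, AddSubgroup.mem_closure_singleton] at hh
    obtain ⟨k, hk⟩ := hh
    exact ⟨k, by rw [← hk, smul_eq_mul, mul_comm]⟩
  have haA : a ∈ A := by
    rw [ha]
    exact AddSubgroup.subset_closure rfl
  have hnA : (n : ℤ) ∈ A := by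
    obtain ⟨m, hm⟩ := hg1
    exact ⟨1, 1 - m, by simp [hm]⟩
  obtain ⟨e, he⟩ := hdvd _ hnA
  have hne : n = a.natAbs * e.natAbs := by
    rw [← Int.natAbs_mul, ← he, Int.natAbs_natCast]
  have he0 : 0 < e.natAbs := Nat.pos_of_ne_zero fun h => by simp [h] at hne; omega
  have ha0 : 0 < a.natAbs := Nat.pos_of_ne_zero fun h => by simp [h] at hne; omega
  have hle := hexp e.natAbs he0 fun σ => by
    obtain ⟨h, hh⟩ := hint σ
    obtain ⟨k, hk⟩ := hdvd h ⟨σ, 0, by simpa using hh⟩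
    have ha' : (a : ℚ) ≠ 0 := by
      have : a ≠ 0 := by omega
      exact_mod_cast this
    have h1 : e * g σ = k := by
      have h2 : ((n : ℤ) : ℚ) = a * e := by rw [he]; push_cast; ring
      have h3 : (h : ℚ) = a * k := by rw [hk]; push_cast; ring
      refine mul_left_cancel₀ ha' ?_
      rw [← h3, ← hh, ← mul_assoc, ← h2]
      norm_cast
    rcases Int.natAbs_eq e with h4 | h4
    · refine ⟨k, ?_⟩
      rw [← h1]
      congr 1
      have := congrArg (Int.cast : ℤ → ℚ) h4.symm
      rwa [Int.cast_natCast] at this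
    · refine ⟨-k, ?_⟩
      push_cast
      rw [← h1, ← neg_mul]
      congr 1
      have : (e.natAbs : ℤ) = -e := by omega
      have := congrArg (Int.cast : ℤ → ℚ) this
      rwa [Int.cast_natCast, Int.cast_neg] at this
  have ha1 : a.natAbs = 1 := by
    have : a.natAbs * e.natAbs ≤ 1 * e.natAbs := by rw [← hne, one_mul]; exact hle
    have := Nat.le_of_mul_le_mul_right this he0
    omega
  have h1A : (1 : ℤ) ∈ A := by
    rcases Int.natAbs_eq a with h | h
    · rw [ha1] at h
      rw [h] at haA
      exact haA
    · rw [ha1] at h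
      rw [h] at haA
      simpa using A.neg_mem haA
  simpa using (hA 1).mp h1A

end Slopes

section Semilinear

variable {K L V : Type*} [Field K] [Field L] [Algebra K L] [AddCommGroup V]
  [Module L V] {f : GaloisCocycle K L}

/-- Semilinear maps with cocycle `f` on an `n`-dimensional space make `n v(f)` the coboundary of an
integral function, namely of the valuations of the determinants. -/
theorem exists_int_eq_mul_of_semilinear [FiniteDimensional K L] [FiniteDimensional L V]
    {u : ∀ σ : Gal(L/K), V →ₛₗ[(σ : L →+* L)] V}
    (hu1 : ∀ w, u 1 w = (f.1 (1, 1) : L) • w)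
    (hu : ∀ σ τ w, u σ (u τ w) = (f.1 (σ, τ) : L) • u (σ * τ) w)
    {v : Valuation L ℤᵐ⁰} (hv : ∀ (σ : Gal(L/K)) a, v (σ a) = v a) {g : Gal(L/K) → ℚ}
    (hg : ∀ σ τ, ∃ m : ℤ, v (f.1 (σ, τ) : L) = exp (-m) ∧ g σ + g τ - g (σ * τ) = m)
    (σ : Gal(L/K)) : ∃ h : ℤ, Module.finrank L V * g σ = h := by
  let b := Module.finBasis L V
  -- Matrices of the semilinear maps: composition becomes a product twisted by `σ`. Taking
  -- determinants gives a one-dimensional relation with `f ^ n`.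
  let U : Gal(L/K) → Matrix _ _ L := fun σ => b.toMatrix fun j => u σ (b j)
  have hU : ∀ σ τ, U σ * (U τ).map σ = (f.1 (σ, τ) : L) • U (σ * τ) := by
    intro σ τ
    refine Matrix.ext fun i j => ?_
    have h1 : u σ (u τ (b j)) = ∑ k, σ (b.repr (u τ (b j)) k) • u σ (b k) := by
      conv_lhs => rw [← b.sum_repr (u τ (b j)), map_sum]
      simp only [map_smulₛₗ]
      rfl
    rw [hu] at h1
    have h2 := congrArg (fun w => b.repr w i) h1
    simp only [map_smul, map_sum, Finsupp.smul_apply, Finsupp.coe_finsetSum,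
      Finset.sum_apply, smul_eq_mul] at h2
    simp only [Matrix.mul_apply, Matrix.map_apply, Matrix.smul_apply, U,
      Module.Basis.toMatrix_apply, smul_eq_mul, h2, mul_comm]
  have hdet : ∀ σ τ, (U σ).det * σ (U τ).det =
      (f.1 (σ, τ) : L) ^ Module.finrank L V * (U (σ * τ)).det := by
    intro σ τ
    have := congrArg Matrix.det (hU σ τ)
    rw [Matrix.det_mul, Matrix.det_smul, Fintype.card_fin] at this
    rw [← this, AlgEquiv.map_det]
    rfl
  have hdet1 : (U 1).det ≠ 0 := by
    have : U 1 = (f.1 (1, 1) : L) • (1 : Matrix _ _ L) := by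
      refine Matrix.ext fun i j => ?_
      simp [U, Module.Basis.toMatrix_apply, hu1, Matrix.one_apply, Finsupp.single_apply, eq_comm]
    rw [this, Matrix.det_smul, Matrix.det_one, mul_one]
    exact pow_ne_zero _ (f.1 (1, 1)).ne_zero
  have hdet0 : ∀ σ, (U σ).det ≠ 0 := fun σ h0 => by
    have := hdet σ σ⁻¹
    rw [h0, zero_mul, mul_inv_cancel, eq_comm] at this
    exact mul_ne_zero (pow_ne_zero _ (f.1 (σ, σ⁻¹)).ne_zero) hdet1 this
  have hvdet : ∀ σ, v (U σ).det ≠ 0 := fun σ => (Valuation.ne_zero_iff v).mpr (hdet0 σ)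
  -- The sign turns the multiplicative value `exp (-m)` into the order `m`.
  refine ⟨-log (v (U σ).det), ?_⟩
  refine congrFun (eq_of_coboundary_eq (g := fun σ => Module.finrank L V * g σ)
    (h := fun σ => ((-log (v (U σ).det) : ℤ) : ℚ)) fun σ τ => ?_) σ
  obtain ⟨m, hm, hm'⟩ := hg σ τ
  have h1 := congrArg (fun a => log (v a)) (hdet σ τ)
  simp only [map_mul, hv, map_pow, hm] at h1
  rw [log_mul (hvdet σ) (hvdet τ), log_mul (pow_ne_zero _ exp_ne_zero) (hvdet _), log_pow,
    log_exp] at h1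
  have h2 := congrArg (fun a : ℤ => (a : ℚ)) h1
  simp only [nsmul_eq_mul] at h2
  push_cast at h2 ⊢
  rw [← mul_add, ← mul_sub, hm']
  linarith

/-- `z • u τ` has slope `g τ + c`: the order of the scalar `y` plus `g (τ ^ k)` grows linearly in
`k`, because the coboundary of `g` is the order of the cocycle. -/
theorem exists_iterate_eq {u : ∀ σ : Gal(L/K), V →ₛₗ[(σ : L →+* L)] V}
    (hu1 : ∀ w, u 1 w = (f.1 (1, 1) : L) • w)
    (hu : ∀ σ τ w, u σ (u τ w) = (f.1 (σ, τ) : L) • u (σ * τ) w)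
    {v : Valuation L ℤᵐ⁰} (hv : ∀ (σ : Gal(L/K)) a, v (σ a) = v a) {g : Gal(L/K) → ℚ}
    (hg : ∀ σ τ, ∃ m : ℤ, v (f.1 (σ, τ) : L) = exp (-m) ∧ g σ + g τ - g (σ * τ) = m)
    {z : L} {c : ℤ} (hz : v z = exp (-c)) (τ : Gal(L/K)) (k : ℕ) :
    ∃ (y : L) (e : ℤ), v y = exp (-e) ∧ e + g (τ ^ k) = k * (g τ + c) ∧
      ∀ w, (z • u τ)^[k] w = y • u (τ ^ k) w := by
  induction k with
  | zero =>
    obtain ⟨m, hm, hm'⟩ := hg 1 1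
    refine ⟨(f.1 (1, 1) : L)⁻¹, -m, ?_, ?_, fun w => ?_⟩
    · rw [map_inv₀, hm, exp_neg, exp_neg, inv_inv, exp_neg, inv_inv]
    · rw [mul_one] at hm'
      push_cast
      rw [pow_zero]
      linarith
    · rw [pow_zero, hu1, smul_smul, inv_mul_cancel₀ (f.1 (1, 1)).ne_zero, one_smul]
      rfl
  | succ k ih =>
    obtain ⟨y, e, hy, he, hx⟩ := ih
    obtain ⟨m, hm, hm'⟩ := hg τ (τ ^ k)
    rw [← pow_succ'] at hm'
    refine ⟨z * τ y * f.1 (τ, τ ^ k), c + e + m, ?_, ?_, fun w => ?_⟩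
    · rw [map_mul, map_mul, hz, hv, hy, hm, ← exp_add, ← exp_add]
      congr 1
      ring
    · push_cast
      linarith
    · rw [Function.iterate_succ_apply', hx, LinearMap.smul_apply, map_smulₛₗ, hu, smul_smul,
        smul_smul, ← pow_succ']
      rfl

end Semilinear

section BrauerEquivalent

variable {K L C : Type*} [Field K] [Field L] [Algebra K L] [FiniteDimensional K L] [IsGalois K L]
  [Ring C] [Algebra K C] [FiniteDimensional K C] {f : GaloisCocycle K L} {n : ℕ}
  {v : Valuation L ℤᵐ⁰} {g : Gal(L/K) → ℚ}

theorem BrauerEquivalent.exists_int_eq_mul (hn : 0 < n) (hC : Module.finrank K C = n ^ 2)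
    (h : BrauerEquivalent K C (CrossedProduct f))
    (hv : ∀ (σ : Gal(L/K)) a, v (σ a) = v a)
    (hg : ∀ σ τ, ∃ m : ℤ, v (f.1 (σ, τ) : L) = exp (-m) ∧ g σ + g τ - g (σ * τ) = m)
    (σ : Gal(L/K)) : ∃ h : ℤ, n * g σ = h := by
  obtain ⟨V, _, _, u, ρ, rfl, hu1, hu, -⟩ := h.exists_semilinear hC
  have : FiniteDimensional L V := Module.finite_of_finrank_pos hn
  exact exists_int_eq_mul_of_semilinear hu1 hu hv hg σ

theorem BrauerEquivalent.isDomain_tensorProduct {F D D' : Type*} [Field F] [IsAlgClosed F]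
    [DivisionRing D] [Algebra F D] [DivisionRing D'] [Algebra F D'] (j : D →+* C) (hn : 0 < n)
    (hC : Module.finrank K C = n ^ 2) (h : BrauerEquivalent K C (CrossedProduct f))
    (hv : ∀ (σ : Gal(L/K)) a, v (σ a) = v a) {z : L} (hz : v z = exp (-1))
    (hg : ∀ σ τ, ∃ m : ℤ, v (f.1 (σ, τ) : L) = exp (-m) ∧ g σ + g τ - g (σ * τ) = m)
    (hexp : ∀ d : ℕ, 0 < d → (∀ σ, ∃ h : ℤ, d * g σ = h) → n ≤ d) :
    IsDomain (D ⊗[F] D') := by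
  obtain ⟨τ, c, hτ⟩ := exists_eq_inv_of_exponent
    (fun σ τ => (hg σ τ).imp fun _ h => h.2) hn (h.exists_int_eq_mul hn hC hv hg) hexp
  obtain ⟨V, _, _, u, ρ, hV, hu1, hu, hρ⟩ := h.exists_semilinear hC
  have hzc : v (z ^ c) = exp (-c) := by
    rw [map_zpow₀, hz, ← exp_zsmul]
    simp
  -- With `|G|` as `s`, the exponent `n s` kills `τ`, so the iterate is the scalar `y f(1,1)`. Its
  -- order is `n |G| (g τ + c) = |G|`; the order `m = g 1` of `f(1,1)` compensates the term `g 1`.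
  obtain ⟨y, e, hy, he, hx⟩ := exists_iterate_eq hu1 hu hv hg hzc τ (n * Nat.card Gal(L/K))
  obtain ⟨m, hm, hm'⟩ := hg 1 1
  have h1 : τ ^ (n * Nat.card Gal(L/K)) = 1 := by rw [mul_comm, pow_mul, pow_card_eq_one', one_pow]
  refine isDomain_tensorProduct_of_slope (τ := (τ : L →+* L)) hn
    (Nat.card_pos (α := Gal(L/K))) hV v (hv τ) (z ^ c • u τ)
    (y := y * f.1 (1, 1)) ?_ (fun w => ?_) (ρ.comp j.op) (fun d w => ?_)
  · rw [map_mul, hy, hm, ← exp_add]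
    congr 1
    rw [h1] at he
    rw [mul_one, add_sub_cancel_right] at hm'
    have : ((e + m : ℤ) : ℚ) = (Nat.card Gal(L/K) : ℤ) := by
      push_cast
      rw [← hm', he]
      push_cast
      linear_combination (Nat.card Gal(L/K) : ℚ) * hτ
    have := Int.cast_injective this
    linarith
  · rw [hx, h1, hu1, smul_smul]
  · rw [LinearMap.smul_apply, LinearMap.smul_apply, map_smul, RingHom.comp_apply, hρ]

end BrauerEquivalent

/-! ### Galois action and valuation on unramified extensions -/

open Polynomial in
/-- A finite group acting on `B` with ring of invariants `A` acts transitively on the homomorphisms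
from `B` to a domain that extend a given one on `A`. -/
theorem Algebra.IsInvariant.exists_eq_smul {A B G Ω : Type*} [CommRing A] [CommRing B] [Algebra A B]
    [Group G] [Finite G] [MulSemiringAction G B] [Algebra.IsInvariant A B G] [CommRing Ω]
    [IsDomain Ω] (φ ψ : B →+* Ω)
    (h : ∀ a, φ (algebraMap A B a) = ψ (algebraMap A B a)) : ∃ σ : G, ∀ b, ψ b = φ (σ • b) := by
  have := Fintype.ofFinite G
  -- The coefficients of `∏ (X - σ t)` are invariant, so `φ` and `ψ` agree on them, and the image of
  -- `t` under `ψ` is a root of the product of the `X - φ (σ t)`.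
  have key : ∀ t : B[X], ∃ σ : G, t.map ψ = (σ • t).map φ := by
    intro t
    let q := MulSemiringAction.charpoly G t
    have hq : ∀ i j, φ ((q.coeff i).coeff j) = ψ ((q.coeff i).coeff j) := by
      intro i j
      obtain ⟨a, ha⟩ := Algebra.IsInvariant.isInvariant (A := A) (G := G) ((q.coeff i).coeff j)
        fun σ => by
          rw [← coeff_smul, MulSemiringAction.smul_coeff_charpoly]
      rw [← ha, h]
    have hq' : q.map (mapRingHom φ) = q.map (mapRingHom ψ) := by
      ext i j
      simp only [coeff_map, coe_mapRingHom]
      exact hq i j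
    have h0 : (q.map (mapRingHom φ)).eval (t.map ψ) = 0 := by
      rw [hq', ← coe_mapRingHom, eval_map_apply, MulSemiringAction.eval_charpoly, map_zero]
    simp only [q, MulSemiringAction.charpoly, Polynomial.map_prod, eval_prod, Polynomial.map_sub,
      map_X, map_C, eval_sub, eval_X, eval_C, coe_mapRingHom, Finset.prod_eq_zero_iff,
      Finset.mem_univ, true_and, sub_eq_zero] at h0
    exact h0
  by_contra! hc
  choose b hb using hc
  let e := Fintype.equivFin G
  -- A single polynomial collects a counterexample for every `σ`; the `σ` found for it contradicts
  -- its own coefficient.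
  let t : B[X] := ∑ σ, C (b σ) * X ^ (e σ : ℕ)
  have ht : ∀ σ, t.coeff (e σ) = b σ := fun σ => by
    simp only [t, finsetSum_coeff, coeff_C_mul_X_pow]
    rw [Finset.sum_eq_single σ]
    · simp
    · intro τ _ hτ
      rw [if_neg fun h => hτ (e.injective (Fin.ext h)).symm]
    · simp
  obtain ⟨σ, hσ⟩ := key t
  refine hb σ ?_
  have := congrArg (fun p => p.coeff (e σ)) hσ
  simpa only [coeff_map, coeff_smul, ht] using this

section Complete

variable {K L : Type*} [Field K] [Field L] [Algebra K L] {Γ : Type*}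
  [LinearOrderedCommGroupWithZero Γ] [Valued K Γ]

/-- The integral closure of a complete valuation ring of rank one in an algebraic extension is
local. -/
theorem isLocalRing_integralClosure_of_complete [CompleteSpace K]
    (hr : (Valued.v : Valuation K Γ).RankOne) [Algebra.IsAlgebraic K L] :
    IsLocalRing (integralClosure (Valued.v : Valuation K Γ).valuationSubring L) := by
  let A := (Valued.v : Valuation K Γ).valuationSubring
  let _ : NontriviallyNormedField K := Valued.toNontriviallyNormedField K Γ
  have : IsUltrametricDist K := inferInstance
  have hA : ∀ a : K, ‖a‖ ≤ 1 ↔ a ∈ A := fun a => Valued.toNormedField.norm_le_one_iff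
  -- Over a complete field the spectral norm is multiplicative and ultrametric. Its unit ball is the
  -- integral closure, and the nonunits are the open unit ball, hence closed under addition.
  have hint : ∀ x : L, IsIntegral A x ↔ spectralNorm K L x ≤ 1 := by
    intro x
    have hx : IsIntegral K x := Algebra.IsIntegral.isIntegral x
    rw [spectralNorm, spectralValue_le_one_iff (minpoly.monic hx)]
    constructor
    · intro h n
      rw [minpoly.isIntegrallyClosed_eq_field_fractions' K h, Polynomial.coeff_map, hA]
      exact Subtype.prop _
    · intro h
      have hl : minpoly K x ∈ Polynomial.lifts (algebraMap A K) := by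
        rw [Polynomial.lifts_iff_coeff_lifts]
        exact fun n => ⟨⟨_, (hA _).mp (h n)⟩, rfl⟩
      obtain ⟨p, hp, -, hpm⟩ := Polynomial.lifts_and_natDegree_eq_and_monic hl (minpoly.monic hx)
      refine ⟨p, hpm, ?_⟩
      rw [IsScalarTower.algebraMap_eq A K L, ← Polynomial.eval₂_map, hp]
      exact minpoly.aeval K x
  have hmul : ∀ x y : L, spectralNorm K L (x * y) = spectralNorm K L x * spectralNorm K L y :=
    spectralAlgNorm_mul
  have hunit : ∀ x : integralClosure A L, IsUnit x ↔ spectralNorm K L (x : L) = 1 := by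
    intro x
    constructor
    · rintro ⟨u, rfl⟩
      have h1 := hmul (u : integralClosure A L) ((u⁻¹ : (integralClosure A L)ˣ) : integralClosure A L)
      rw [← Subalgebra.coe_mul, Units.mul_inv, Subalgebra.coe_one, spectralNorm_one] at h1
      refine le_antisymm ((hint _).mp (u : integralClosure A L).2) ?_
      rw [h1]
      exact mul_le_of_le_one_right (spectralNorm_nonneg _)
        ((hint _).mp ((u⁻¹ : (integralClosure A L)ˣ) : integralClosure A L).2)
    · intro h
      have hx0 : (x : L) ≠ 0 := fun h0 => by
        rw [h0, spectralNorm_zero] at h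
        exact zero_ne_one h
      have h1 := hmul x (x : L)⁻¹
      rw [mul_inv_cancel₀ hx0, spectralNorm_one, h, one_mul] at h1
      exact IsUnit.of_mul_eq_one ⟨(x : L)⁻¹, (hint _).mpr h1.symm.le⟩
        (Subtype.ext (mul_inv_cancel₀ hx0))
  refine IsLocalRing.of_nonunits_add fun a b ha hb => ?_
  rw [mem_nonunits_iff, hunit] at ha hb ⊢
  have ha' := lt_of_le_of_ne ((hint _).mp a.2) ha
  have hb' := lt_of_le_of_ne ((hint _).mp b.2) hb
  exact ((isNonarchimedean_spectralNorm (K := K) (a : L) b).trans_lt (max_lt ha' hb')).ne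

end Complete

/-- The normalized valuation of a finite Galois extension, where the integral closure of a discrete
valuation ring `A` is local and unramified over `A`. -/
theorem exists_valuation_of_formallyUnramified {A K L : Type*} [CommRing A] [IsDomain A]
    [IsDiscreteValuationRing A] [Field K] [Algebra A K] [IsFractionRing A K] [Field L] [Algebra K L]
    [Algebra A L] [IsScalarTower A K L] [FiniteDimensional K L] [IsGalois K L]
    [IsLocalRing (integralClosure A L)] [Algebra.FormallyUnramified A (integralClosure A L)] :
    ∃ v : Valuation L ℤᵐ⁰, (∀ (σ : Gal(L/K)) a, v (σ a) = v a) ∧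
      (∀ w : (integralClosure A L)ˣ, v ((w : integralClosure A L) : L) = 1) ∧
      ∀ ϖ : A, Irreducible ϖ → v (algebraMap A L ϖ) = exp (-1) := by
  have : IsDedekindDomain (integralClosure A L) := integralClosure.isDedekindDomain A K L
  have : IsFractionRing (integralClosure A L) L :=
    integralClosure.isFractionRing_of_finite_extension K L
  have : Module.Finite A (integralClosure A L) := IsIntegralClosure.finite A K L _
  have hinj : Function.Injective (algebraMap A (integralClosure A L)) := by
    have : Function.Injective (algebraMap A L) := by
      rw [IsScalarTower.algebraMap_eq A K L]
      exact (algebraMap K L).injective.comp (IsFractionRing.injective A K)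
    exact fun a b h => this (congrArg (algebraMap (integralClosure A L) L) h)
  have : FaithfulSMul A (integralClosure A L) :=
    (faithfulSMul_iff_algebraMap_injective _ _).mpr hinj
  have : IsLocalHom (algebraMap A (integralClosure A L)) := inferInstance
  have hmax := Algebra.FormallyUnramified.map_maximalIdeal (R := A) (S := integralClosure A L)
  -- Unramifiedness enters here: a uniformizer of `A` stays a uniformizer.
  have hspan : ∀ ϖ : A, Irreducible ϖ → IsLocalRing.maximalIdeal (integralClosure A L) =
      Ideal.span {algebraMap A (integralClosure A L) ϖ} := fun ϖ hϖ => by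
    rw [← hmax, hϖ.maximalIdeal_eq, Ideal.map_span, Set.image_singleton]
  obtain ⟨ϖ₀, hϖ₀⟩ := IsDiscreteValuationRing.exists_irreducible A
  have hne : ∀ ϖ : A, Irreducible ϖ → algebraMap A (integralClosure A L) ϖ ≠ 0 := fun ϖ hϖ h0 =>
    hϖ.ne_zero (hinj (h0.trans (map_zero _).symm))
  let P : IsDedekindDomain.HeightOneSpectrum (integralClosure A L) :=
    { asIdeal := IsLocalRing.maximalIdeal _
      isPrime := inferInstance
      ne_bot := fun h => hne ϖ₀ hϖ₀ (by
        have := hspan ϖ₀ hϖ₀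
        rw [h, eq_comm, Ideal.span_singleton_eq_bot] at this
        exact this) }
  have hP : ∀ Q : IsDedekindDomain.HeightOneSpectrum (integralClosure A L), Q = P := fun Q =>
    IsDedekindDomain.HeightOneSpectrum.ext (IsLocalRing.eq_maximalIdeal Q.isMaximal)
  have hunit : ∀ w : integralClosure A L, P.valuation L (w : L) = 1 ↔ IsUnit w := fun w => by
    have := P.valuation_eq_one_iff_notMem (K := L) (r := w)
    refine this.trans ?_
    exact IsLocalRing.notMem_maximalIdeal
  have hϖ : ∀ ϖ : A, Irreducible ϖ → P.valuation L (algebraMap A L ϖ) = exp (-1) := fun ϖ hϖ => by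
    have h1 := P.valuation_of_algebraMap (K := L) (algebraMap A (integralClosure A L) ϖ)
    rw [P.intValuation_singleton (hne ϖ hϖ) (hspan ϖ hϖ)] at h1
    exact h1
  have hσ1 : ∀ (σ : Gal(L/K)) y, P.valuation L y = 1 → P.valuation L (σ y) = 1 := by
    intro σ y hy
    obtain ⟨y', rfl⟩ := IsDedekindDomain.HeightOneSpectrum.mem_integers_of_valuation_le_one L y
      (fun Q => by rw [hP Q, hy]) (R := integralClosure A L)
    have hu := (hunit y').mp hy
    have h2 : IsIntegral A (σ (y' : L)) := y'.2.map (σ.restrictScalars A)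
    obtain ⟨z, hz⟩ := hu.exists_right_inv
    have h3 : IsIntegral A (σ (z : L)) := z.2.map (σ.restrictScalars A)
    refine (hunit ⟨_, h2⟩).mpr (IsUnit.of_mul_eq_one ⟨_, h3⟩ (Subtype.ext ?_))
    change σ (y' : L) * σ (z : L) = 1
    rw [← map_mul, ← Subalgebra.coe_mul, hz, Subalgebra.coe_one, map_one]
  refine ⟨P.valuation L, fun σ a => ?_, fun w => (hunit w).mpr w.isUnit, hϖ⟩
  by_cases ha : a = 0
  · simp [ha]
  have hva : P.valuation L a ≠ 0 := (Valuation.ne_zero_iff _).mpr ha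
  have hp0 : algebraMap A L ϖ₀ ≠ 0 := fun h0 => by
    have := hϖ ϖ₀ hϖ₀
    rw [h0, map_zero] at this
    exact exp_ne_zero this.symm
  set k := log (P.valuation L a) with hk
  -- Up to a power of the Galois-fixed uniformizer, `a` is a unit, and units are permuted by the
  -- Galois group.
  set y := a * algebraMap A L ϖ₀ ^ k with hy
  have hvy : P.valuation L y = 1 := by
    rw [hy, map_mul, map_zpow₀, hϖ ϖ₀ hϖ₀, ← exp_zsmul, ← exp_log hva, ← exp_add, ← hk]
    simp
  have hvσ := hσ1 σ y hvy
  have hfix : σ (algebraMap A L ϖ₀) = algebraMap A L ϖ₀ := by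
    rw [IsScalarTower.algebraMap_apply A K L, AlgEquiv.commutes]
  rw [hy, map_mul, map_zpow₀, hfix, map_mul] at hvσ
  rw [hy, map_mul] at hvy
  refine mul_right_cancel₀ ?_ (hvσ.trans hvy.symm)
  exact (Valuation.ne_zero_iff _).mpr (zpow_ne_zero _ hp0)

/-! ### The completion and the ramification character -/

section Completion

variable (R F₁ : Type*) [CommRing R] [IsDomain R] [IsDiscreteValuationRing R]
  [Field F₁] [Algebra R F₁] [IsFractionRing R F₁]

theorem valued_algebraMap_of_irreducible {π : R} (hπ : Irreducible π) :
    Valued.v (algebraMap F₁ (CompletedField R F₁) (algebraMap R F₁ π)) = exp (-1) := by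
  have h1 := IsDedekindDomain.HeightOneSpectrum.valuedAdicCompletion_eq_valuation' (K := F₁)
    (IsDiscreteValuationRing.maximalIdeal R) (algebraMap R F₁ π)
  rw [IsDedekindDomain.HeightOneSpectrum.valuation_of_algebraMap,
    IsDedekindDomain.HeightOneSpectrum.intValuation_singleton _ hπ.ne_zero hπ.maximalIdeal_eq] at h1
  exact h1

theorem irreducible_algebraMap_completedRing {π : R} (hπ : Irreducible π) :
    Irreducible (algebraMap R (CompletedRing R F₁) π) := by
  have hv := valued_algebraMap_of_irreducible R F₁ hπ
  have hv' : Valued.v (algebraMap R (CompletedRing R F₁) π : CompletedField R F₁) = exp (-1) := hv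
  have h0 : algebraMap R (CompletedRing R F₁) π ≠ 0 := fun h => by
    rw [h, ZeroMemClass.coe_zero, map_zero] at hv'
    exact exp_ne_zero hv'.symm
  refine IsDiscreteValuationRing.irreducible_of_span_eq_maximalIdeal _ h0 ?_
  ext a
  rw [Ideal.mem_span_singleton]
  have hmem : a ∈ IsLocalRing.maximalIdeal (CompletedRing R F₁) ↔
      Valued.v (a : CompletedField R F₁) < 1 := Valuation.mem_maximalIdeal_iff _ _
  rw [hmem]
  constructor
  · intro h
    refine ⟨⟨(a : CompletedField R F₁) / (algebraMap R (CompletedRing R F₁) π), ?_⟩,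
      Subtype.ext ?_⟩
    · rw [IsDedekindDomain.HeightOneSpectrum.mem_adicCompletionIntegers, map_div₀, hv']
      refine (div_le_one₀ exp_pos).mpr ?_
      by_cases ha : Valued.v (a : CompletedField R F₁) = 0
      · rw [ha]
        exact zero_le
      · rw [← exp_log ha] at h ⊢
        rw [← exp_zero, exp_lt_exp] at h
        rw [exp_le_exp]
        omega
    · have h0' : (algebraMap R (CompletedRing R F₁) π : CompletedField R F₁) ≠ 0 :=
        fun h => h0 (Subtype.ext h)
      exact (mul_div_cancel₀ _ h0').symm
  · rintro ⟨b, rfl⟩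
    have hb := (IsDedekindDomain.HeightOneSpectrum.mem_adicCompletionIntegers _ _ _).mp b.2
    change Valued.v ((algebraMap R (CompletedRing R F₁) π : CompletedField R F₁) * b) < 1
    rw [map_mul, hv']
    refine (mul_le_of_le_one_right' hb).trans_lt ?_
    rw [← exp_zero, exp_lt_exp]
    norm_num

/-- Every element of the completion of `R` is congruent to an element of `R`. -/
theorem exists_sub_mem_maximalIdeal (a : CompletedRing R F₁) :
    ∃ r : R, a - algebraMap R (CompletedRing R F₁) r ∈
      IsLocalRing.maximalIdeal (CompletedRing R F₁) := by
  have hopen : IsOpen {x : CompletedField R F₁ | Valued.v (x - a) < 1} := by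
    have h1 := (Valued.isOpen_ball (CompletedField R F₁)
      (1 : MonoidWithZeroHom.ValueGroup₀ (.ofClass (Valued.v :
        Valuation (CompletedField R F₁) ℤᵐ⁰)))).preimage
      (continuous_id.sub (continuous_const (y := (a : CompletedField R F₁))))
    simpa [Set.preimage, Valuation.restrict_lt_one_iff] using h1
  -- `F₁` is dense in its completion; an approximation of an integral element is itself integral and
  -- so lies in `R`.
  obtain ⟨c, hc⟩ := (IsDedekindDomain.HeightOneSpectrum.denseRange_algebraMap (K := F₁)
    (IsDiscreteValuationRing.maximalIdeal R)).exists_mem_open hopen ⟨a, by simp⟩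
  have ha := (IsDedekindDomain.HeightOneSpectrum.mem_adicCompletionIntegers _ _ _).mp a.2
  have hc1 : Valued.v (algebraMap F₁ (CompletedField R F₁) c) ≤ 1 := by
    rw [← sub_add_cancel (algebraMap F₁ (CompletedField R F₁) c) a]
    exact (Valuation.map_add _ _ _).trans (max_le (le_of_lt hc) ha)
  have hc2 := IsDedekindDomain.HeightOneSpectrum.valuedAdicCompletion_eq_valuation' (K := F₁)
    (IsDiscreteValuationRing.maximalIdeal R) c
  obtain ⟨r, rfl⟩ := IsDiscreteValuationRing.exists_lift_of_le_one (A := R) (K := F₁)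
    (x := c) (hc2.symm.trans_le hc1)
  refine ⟨r, ?_⟩
  refine (Valuation.mem_maximalIdeal_iff _ _).mpr ?_
  rw [← Valuation.map_neg]
  refine lt_of_eq_of_lt (congrArg _ ?_) hc
  exact neg_sub _ _

variable {R F₁}

/-- The data in the definition of the ramification map, in terms of a Galois-invariant normalized
valuation. -/
theorem IsRamification.exists_valuation {D : Type*} [Ring D] [Algebra F₁ D]
    {χ : CharacterGroup (IsLocalRing.ResidueField R)} (h : IsRamification R F₁ D χ) :
    ∃ (L : IntermediateField (CompletedField R F₁) (AlgebraicClosure (CompletedField R F₁)))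
      (_ : FiniteDimensional (CompletedField R F₁) L) (_ : IsGalois (CompletedField R F₁) L)
      (f : GaloisCocycle (CompletedField R F₁) L) (g : Gal(L/(CompletedField R F₁)) → ℚ)
      (v : Valuation L ℤᵐ⁰) (z : L),
      BrauerEquivalent (CompletedField R F₁) (CompletedField R F₁ ⊗[F₁] D) (CrossedProduct f) ∧
      (∀ (σ : Gal(L/(CompletedField R F₁))) a, v (σ a) = v a) ∧ v z = exp (-1) ∧
      (∀ σ τ, ∃ m : ℤ, v (f.1 (σ, τ) : L) = exp (-m) ∧ g σ + g τ - g (σ * τ) = m) ∧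
      ∀ d : ℕ, (∀ σ, ∃ h : ℤ, d * g σ = h) → χ ^ d = 1 := by
  obtain ⟨L, _, _, f, g, φ, hunr, hB, hval, hφ, hχ⟩ := h
  have : IsLocalRing (IntegersOf R L) :=
    isLocalRing_integralClosure_of_complete
      -- Any base greater than `1` gives a real-valued norm.
      (Valuation.IsRankOneDiscrete.rankOne _ (e := 2) one_lt_two)
  obtain ⟨v, hv, hv1, hvϖ⟩ := exists_valuation_of_formallyUnramified
    (A := CompletedRing R F₁) (K := CompletedField R F₁) (L := L)
  obtain ⟨π₀, hπ₀⟩ := IsDiscreteValuationRing.exists_irreducible R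
  have hvπ : ∀ π : R, Irreducible π → v (algebraMap (CompletedField R F₁) L
      (algebraMap F₁ (CompletedField R F₁) (algebraMap R F₁ π))) = exp (-1) := fun π hπ =>
    hvϖ _ (irreducible_algebraMap_completedRing R F₁ hπ)
  refine ⟨L, inferInstance, inferInstance, f, g, v, _, hB, hv, hvπ π₀ hπ₀, fun σ τ => ?_,
    fun d hd => ?_⟩
  · obtain ⟨m, ⟨π, w, hπ, hx⟩, hm⟩ := hval σ τ
    refine ⟨m, ?_, hm⟩
    rw [hx, map_mul, hv1, one_mul, map_zpow₀, hvπ π hπ, ← exp_zsmul]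
    simp
  · refine Subtype.ext (MonoidHom.ext fun s => ?_)
    -- `φ` kills the uniformizer, so on the completion of `R` it takes values in `k`, which every
    -- `s` fixes.
    have hA : ∀ a : CompletedRing R F₁, ∃ r : R, φ (algebraMap _ (IntegersOf R L) a) =
        algebraMap (IsLocalRing.ResidueField R) _ (IsLocalRing.residue R r) := by
      intro a
      obtain ⟨r, hr⟩ := exists_sub_mem_maximalIdeal R F₁ a
      rw [(irreducible_algebraMap_completedRing R F₁ hπ₀).maximalIdeal_eq,
        Ideal.mem_span_singleton] at hr
      obtain ⟨b, hb⟩ := hr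
      refine ⟨r, ?_⟩
      have hπ0 : IsLocalRing.residue R π₀ = 0 := by
        rw [IsLocalRing.residue_eq_zero_iff, IsLocalRing.mem_maximalIdeal]
        exact hπ₀.not_isUnit
      rw [← hφ, ← sub_eq_zero, ← map_sub, ← map_sub, hb, map_mul, map_mul, hφ, hπ0, map_zero,
        zero_mul]
    have : IsFractionRing (IntegersOf R L) L :=
      integralClosure.isFractionRing_of_finite_extension (CompletedField R F₁) L
    have hinv : Algebra.IsInvariant (CompletedRing R F₁) (IntegersOf R L)
        Gal(L/(CompletedField R F₁)) := ⟨fun b hb =>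
      (Algebra.isInvariant_of_isGalois (CompletedRing R F₁) (CompletedField R F₁) L
        (IntegersOf R L)).isInvariant b fun σ => Subtype.ext <|
          (algebraMap_galRestrict_apply (CompletedRing R F₁) σ b).trans
            (congrArg Subtype.val (hb σ))⟩
    -- Every `s` is matched by some `σ` with `φ ∘ σ = s ∘ φ`, so every value of `χ` is a value of
    -- `g` modulo `ℤ`.
    obtain ⟨σ, hσ⟩ := Algebra.IsInvariant.exists_eq_smul (A := CompletedRing R F₁)
      (G := Gal(L/(CompletedField R F₁))) φ
      ((s : AlgebraicClosure (IsLocalRing.ResidueField R) →+*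
        AlgebraicClosure (IsLocalRing.ResidueField R)).comp φ) (fun a => by
          obtain ⟨r, hr⟩ := hA a
          rw [RingHom.comp_apply, hr]
          exact (s.commutes _).symm)
    have h1 := hχ s σ fun b b' hb => by
      have h2 := hσ b
      rw [RingHom.comp_apply] at h2
      refine Eq.trans ?_ h2.symm
      exact congrArg φ (Subtype.ext hb)
    obtain ⟨m, hm⟩ := hd σ
    change (χ.1 ^ d) s = 1
    rw [MonoidHom.pow_apply, h1, ← ofAdd_nsmul, ← AddCircle.coe_nsmul, nsmul_eq_mul, hm]
    refine Multiplicative.toAdd.injective ?_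
    rw [toAdd_ofAdd, toAdd_one, AddCircle.coe_eq_zero_iff]
    exact ⟨m, by simp⟩

/-- The order of the ramification divides the degree. -/
theorem IsRamification.pow_degree_eq_one {D : Type*} [Ring D] [Algebra F₁ D]
    [FiniteDimensional F₁ D] {χ : CharacterGroup (IsLocalRing.ResidueField R)}
    (h : IsRamification R F₁ D χ) {n : ℕ} (hn : 0 < n) (hD : HasDegree F₁ D n) : χ ^ n = 1 := by
  obtain ⟨L, _, _, f, g, v, z, hB, hv, -, hg, hχ⟩ := h.exists_valuation
  exact hχ n (hB.exists_int_eq_mul hn (Module.finrank_baseChange.trans hD) hv hg)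

/-- A multiple `d g` that is integral gives `χ ^ d = 1`, hence `d` is at least the order of `χ`,
which is the degree. This is the minimality needed to find slope `1 / n`. -/
theorem IsTotallyRamifiedAt.isDomain_tensorProduct {F D D' : Type*} [Field F] [IsAlgClosed F]
    [DivisionRing D] [Algebra F D] [Algebra F₁ D] [FiniteDimensional F₁ D] [DivisionRing D']
    [Algebra F D'] (h : IsTotallyRamifiedAt R F₁ D) : IsDomain (D ⊗[F] D') := by
  obtain ⟨χ, hχ, hdeg⟩ := h
  have hn : 0 < orderOf χ := Nat.pos_of_ne_zero fun h0 => by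
    rw [HasDegree, h0, zero_pow two_ne_zero] at hdeg
    exact Module.finrank_pos.ne' hdeg
  obtain ⟨L, _, _, f, g, v, z, hB, hv, hz, hg, hord⟩ := hχ.exists_valuation
  exact hB.isDomain_tensorProduct
    (Algebra.TensorProduct.includeRight (R := F₁) (A := CompletedField R F₁) (B := D)).toRingHom hn
    (Module.finrank_baseChange.trans hdeg) hv hz hg
    fun d hd hint => orderOf_le_of_pow_eq_one hd (hord d hint)

theorem IsRamifiedAt.isTotallyRamifiedAt_of_prime {D : Type*} [Ring D] [Algebra F₁ D]
    [FiniteDimensional F₁ D] {p : ℕ} (hp : p.Prime) (hD : HasDegree F₁ D p)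
    (h : IsRamifiedAt R F₁ D) : IsTotallyRamifiedAt R F₁ D := by
  obtain ⟨χ, hχ, h1⟩ := h
  have := Fact.mk hp
  exact ⟨χ, hχ, by rwa [orderOf_eq_prime (hχ.pow_degree_eq_one hp.pos hD) h1]⟩

end Completion

theorem theorem1p2
    (F : Type*) [Field F] [IsAlgClosed F]
    -- two division algebras, finite-dimensional over their centers, which contain `F`
    (F₁ : Type*) [Field F₁] [Algebra F F₁]
    (D₁ : Type*) [DivisionRing D₁] [Algebra F D₁] [Algebra F₁ D₁] [IsScalarTower F F₁ D₁]
    [Algebra.IsCentral F₁ D₁] [FiniteDimensional F₁ D₁]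
    (F₂ : Type*) [Field F₂] [Algebra F F₂]
    (D₂ : Type*) [DivisionRing D₂] [Algebra F D₂] [Algebra F₂ D₂] [IsScalarTower F F₂ D₂]
    [Algebra.IsCentral F₂ D₂] [FiniteDimensional F₂ D₂]
    -- a discrete valuation ring with fraction field `F₁`
    (R : Type*) [CommRing R] [IsDomain R] [IsDiscreteValuationRing R]
    [Algebra R F₁] [IsFractionRing R F₁] :
    (IsTotallyRamifiedAt R F₁ D₁ → IsDomain (D₁ ⊗[F] D₂)) ∧
    (∀ p : ℕ, p.Prime → p ≠ ringChar F → HasDegree F₁ D₁ p → IsRamifiedAt R F₁ D₁ →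
      IsDomain (D₁ ⊗[F] D₂)) :=
  ⟨fun h => h.isDomain_tensorProduct,
    fun _ hp _ hD h => (h.isTotallyRamifiedAt_of_prime hp hD).isDomain_tensorProduct⟩
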